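/- **Problem King.** An instance is a Boolean circuit $C:\{0,1\}^n\times\{0,1\}^n\to\{0,1\}$ (gates of fan-in at most two), viewed as a digraph on the vertex set $\{0,1\}^n\cong[2^n]$ with an edge from $x$ to $y$ if and only if $C(x,y)=1$. A solution is either 1. a pair of distinct vertices $x_1\ne x_2$ with $C(x_1,x_2)=C(x_2,x_1)$ (a proof that $C$ is not a tournament), or 2. a vertex $k$ (a king) such that for every vertex $a\neq k$, either $C(k,a)=1$ or there is a vertex $b\notin\{k,a\}$ with $C(k,b)=1$ and $C(b,a)=1$. **Theorem.** There is a $\mathrm{poly}(n)\cdot 2^n$-time algorithm with an $\mathsf{NP}$ oracle for King. Precisely: there are a language $L\in\mathsf{NP}$, a deterministic oracle Turing machine $M$ and a polynomial $p$ such that for every $n\ge 0$ and every circuit $C:\{0,1\}^n\times\{0,1\}^n\to\{0,1\}$ with $s$ gates, the machine $M^L$, given (a standard encoding of) $C$, halts with (the encoding of) a solution of the King instance $C$ after at most $p(n+s)\cdot 2^n$ steps, where each oracle query is one step; moreover it makes at most $2^n+p(n+s)$ oracle queries, each of length at most $p(n+s)$. In particular, for circuits of size $s\le\mathrm{poly}(n)$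 the running time is $\mathrm{poly}(n)\cdot 2^n$. -/

import Mathlib

/-! ### Boolean circuits -/

/-- A gate of fan-in at most two. Its arguments are wire numbers. -/
inductive BoolGate where
  | const (b : Bool)
  | not (i : ℕ)
  | and (i j : ℕ)
  | or (i j : ℕ)

/-- The wires read by a gate. -/
def BoolGate.args : BoolGate → List ℕ
  | .const _ => []
  | .not i => [i]
  | .and i j => [i, j]
  | .or i j => [i, j]

/-- The value of a gate, given the list of the values of all earlier wires.
The default value `false` is never used in a circuit, by `BoolCircuit.args_lt`. -/
def BoolGate.eval (w : List Bool) : BoolGate → Bool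
  | .const b => b
  | .not i => !(w.getD i false)
  | .and i j => w.getD i false && w.getD j false
  | .or i j => w.getD i false || w.getD j false

/-- A Boolean circuit with `m` input bits and one output bit: the wires `0, …, m - 1` are the
inputs, wire `m + t` is the value of the `t`-th gate, which reads only earlier wires, and `out` is
the output wire. -/
structure BoolCircuit (m : ℕ) where
  gates : List BoolGate
  out : ℕ
  args_lt : ∀ (t : ℕ) (ht : t < gates.length), ∀ i ∈ (gates[t]).args, i < m + t
  out_lt : out < m + gates.length

namespace BoolCircuit

variable {m : ℕ}

/-- The size of a circuit is its number of gates. -/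
def size (C : BoolCircuit m) : ℕ := C.gates.length

/-- The values of all wires. -/
def wires (C : BoolCircuit m) (x : Fin m → Bool) : List Bool :=
  C.gates.foldl (fun w g => w ++ [g.eval w]) (List.ofFn x)

/-- The output of the circuit. -/
def eval (C : BoolCircuit m) (x : Fin m → Bool) : Bool :=
  (C.wires x).getD C.out false

end BoolCircuit

/-! ### Encoding of circuits by bit strings

Wire numbers are written in unary. As they are smaller than the number of wires, the code of a
circuit has length polynomial in the number of its inputs and gates. -/

/-- The self-delimiting unary code `1 ⋯ 1 0`. -/
def unaryCode (i : ℕ) : List Bool := List.replicate i true ++ [false]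

def BoolGate.encode : BoolGate → List Bool
  | .const b => [false, false, b]
  | .not i => [false, true] ++ unaryCode i
  | .and i j => [true, false] ++ unaryCode i ++ unaryCode j
  | .or i j => [true, true] ++ unaryCode i ++ unaryCode j

def BoolCircuit.encode {m : ℕ} (C : BoolCircuit m) : List Bool :=
  unaryCode m ++ unaryCode C.out ++ C.gates.flatMap BoolGate.encode

/-! ### The search problem King -/

/-- The vertices are the elements of `{0,1}^n`, identified with `[2^n]`. A circuit with `n + n`
inputs is a digraph: there is an edge from `x` to `y` if and only if `C(x, y) = 1`. -/
def kingEdge {n : ℕ} (C : BoolCircuit (n + n)) (x y : Fin n → Bool) : Bool :=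
  C.eval (Fin.append x y)

/-- The possible answers: two vertices violating the tournament property, or a king. -/
inductive KingAnswer (n : ℕ) where
  | violation (x₁ x₂ : Fin n → Bool)
  | king (k : Fin n → Bool)

/-- The answer `a` is a solution of the instance `C` of King. -/
def KingAnswer.IsSolution {n : ℕ} (C : BoolCircuit (n + n)) : KingAnswer n → Prop
  | .violation x₁ x₂ => x₁ ≠ x₂ ∧ kingEdge C x₁ x₂ = kingEdge C x₂ x₁
  | .king k => ∀ a : Fin n → Bool, a ≠ k →
      kingEdge C k a = true ∨
        ∃ b : Fin n → Bool, b ≠ k ∧ b ≠ a ∧ kingEdge C k b = true ∧ kingEdge C b a = true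

/-- An answer as a bit string: a bit for its kind, followed by the bits of the vertices. -/
def KingAnswer.encode {n : ℕ} : KingAnswer n → List Bool
  | .violation x₁ x₂ => false :: (List.ofFn x₁ ++ List.ofFn x₂)
  | .king k => true :: List.ofFn k

/-! ### The class NP -/

/-- A pair of bit strings as one string over a four-letter alphabet, in which the letters of the
first and of the second component are distinguishable. -/
def encodeStringPair (p : List Bool × List Bool) : List (Bool ⊕ Bool) :=
  p.1.map Sum.inl ++ p.2.map Sum.inr

/-- `L` is in NP: membership is witnessed by certificates of polynomial length that are checked by
a deterministic polynomial-time Turing machine. -/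
def InNP (L : Set (List Bool)) : Prop :=
  ∃ (V : List Bool × List Bool → Bool) (q : Polynomial ℕ),
    Nonempty (Turing.TM2ComputableInPolyTime encodeStringPair Computability.encodeBool V) ∧
    ∀ x : List Bool, x ∈ L ↔ ∃ w : List Bool, w.length ≤ q.eval x.length ∧ V (x, w) = true

/-! ### Oracle Turing machines -/

/-- A deterministic oracle Turing machine over the alphabet `{0,1}`: a multi-stack Turing machine
with an oracle stack `kq` and three special control labels `query`, `yes` and `no`. -/
structure OracleTM where
  tm : Turing.FinTM2
  inputAlphabet : tm.Γ tm.k₀ ≃ Bool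
  outputAlphabet : tm.Γ tm.k₁ ≃ Bool
  kq : tm.K
  queryAlphabet : tm.Γ kq ≃ Bool
  query : tm.Λ
  yes : tm.Λ
  no : tm.Λ

namespace OracleTM

variable (M : OracleTM)

/-- The word on the oracle stack, read from the top. -/
def queryWord (c : M.tm.Cfg) : List Bool := (c.stk M.kq).map M.queryAlphabet

open Classical in
/-- The effect of a query: the control goes to `yes` or `no` according to the membership of the
query word in the oracle, and the oracle stack is emptied. -/
noncomputable def answer (O : Set (List Bool)) (c : M.tm.Cfg) : M.tm.Cfg where
  l := some (if M.queryWord c ∈ O then M.yes else M.no)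
  var := c.var
  stk := Function.update c.stk M.kq []

/-- `M.Run O c t qs c'`: with the oracle `O`, the machine goes from `c` to `c'` in exactly `t`
steps, and `qs` is the list of the words queried on the way. A query is one step. -/
inductive Run (O : Set (List Bool)) :
    M.tm.Cfg → ℕ → List (List Bool) → M.tm.Cfg → Prop
  | refl (c : M.tm.Cfg) : Run O c 0 [] c
  | step {c c' c'' : M.tm.Cfg} {t : ℕ} {qs : List (List Bool)}
      (hl : c.l ≠ some M.query) (hs : M.tm.step c = some c') (hr : Run O c' t qs c'') :
      Run O c (t + 1) qs c''
  | query {c c'' : M.tm.Cfg} {t : ℕ} {qs : List (List Bool)}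
      (hl : c.l = some M.query) (hr : Run O (M.answer O c) t qs c'') :
      Run O c (t + 1) (M.queryWord c :: qs) c''

/-- With the oracle `O` and the input `x`, the machine halts after exactly `t` steps with the
output `y`, having queried the words `qs`. -/
def Computes (O : Set (List Bool)) (x y : List Bool) (t : ℕ) (qs : List (List Bool)) : Prop :=
  ∃ c : M.tm.Cfg,
    M.Run O (Turing.initList M.tm (x.map M.inputAlphabet.symm)) t qs c ∧
    c.l = none ∧ (c.stk M.tm.k₁).map M.outputAlphabet = y

end OracleTM

/-! The heart of the matter is an exchange argument in tournaments. Suppose that `a` is not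
reachable from `k` by a path of length at most two, and let `b` be the middle vertex of such a path
from `k` to `x`. If neither `a = b` nor `a → b`, then `b → a`, and `a` would be reachable from `k`
over `b`. So `a` reaches `b`, and hence `x`, and `a` dominates in two steps everything that `k` does
(`Near.of_not_near`). A king is therefore found by one scan over the vertices `a` with a current
candidate `k`: one query decides whether `k` is near `a`, and if not, `k` is replaced by `a`. The
scan costs `2 ^ n` queries (`runs_king`).

The argument needs a tournament, so a violation is looked for beforehand by a prefix search on the
`2 * n` interleaved bits of a pair of vertices: each query asks whether some violation extends the
current prefix by `true` (`Progress.no`, `runs_search`). The search ends either with a violation or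
with the knowledge that there is none.

Both kinds of queries are put to a single language, tagged by a bit. A certificate supplies the
missing bits of the violation, or the middle vertex of the path. In either case the circuit has to
be evaluated at just two inputs, which the verifier does simultaneously, with pairs of bits as wire
values. What the language says on well-formed queries is stated in `mem_oracle_false` and
`mem_oracle_true`.

The remaining work is the analysis of two explicit stack machines. Membership in NP requires a time
bound on all words, so the lemmas on the verifier have two halves: termination in bounded time for
arbitrary stack contents, and the outcome if the contents are well-formed. The code of a circuit has
quadratic length, hence each of the at most `2 * n + 2 ^ n` rounds of the oracle machine takes
polynomial time. -/

/-! ### Counting steps of a transition function -/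

/-- The transition function `f` leads from `a` to `b` in at most `T` steps. -/
def ReachesIn {α : Type*} (f : α → Option α) (T : ℕ) (a b : α) : Prop :=
  ∃ t ≤ T, (flip bind f)^[t] (some a) = some b

namespace ReachesIn

variable {α : Type*} {f : α → Option α} {T T' : ℕ} {a b c : α}

theorem trans (h : ReachesIn f T a b) (h' : ReachesIn f T' b c) : ReachesIn f (T + T') a c := by
  obtain ⟨t, ht, e⟩ := h
  obtain ⟨t', ht', e'⟩ := h'
  refine ⟨t' + t, by omega, ?_⟩
  rw [Function.iterate_add_apply, e, e']

theorem single (h : f a = some b) : ReachesIn f 1 a b := ⟨1, le_rfl, h⟩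

theorem mono (h : ReachesIn f T a b) (hT : T ≤ T') : ReachesIn f T' a b := by
  obtain ⟨t, ht, e⟩ := h
  exact ⟨t, ht.trans hT, e⟩

theorem head (h : f a = some b) (h' : ReachesIn f T b c) : ReachesIn f (T + 1) a c :=
  ((single h).trans h').mono (by omega)

end ReachesIn

/-! ### The verifier -/

namespace Verifier

/-- The stacks of the verifier: the input, the code of the circuit, the prefix in the query, the
certificate, the output (also used for the number of the output wire), two auxiliary stacks, and
the list of the values of the wires on two inputs of the circuit. -/
inductive Stack
  | inp | code | pre | cert | out | aux | aux' | wires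
  deriving DecidableEq

instance : Fintype Stack :=
  ⟨{.inp, .code, .pre, .cert, .out, .aux, .aux', .wires}, fun k => by cases k <;> decide⟩

/-- The alphabets of the stacks of the verifier. -/
abbrev Letter : Stack → Type
  | .inp => Bool ⊕ Bool
  | .aux | .aux' | .wires => Bool × Bool
  | .code | .pre | .cert | .out => Bool

/-- What to do with the value of a wire that has been looked up. -/
inductive Purpose
  | neg
  | first (conj : Bool)
  | second (conj : Bool) (v : Bool × Bool)
  deriving DecidableEq, Fintype

/-- The control labels of the verifier. -/
inductive Label
  | start | parse | split | inputs | loadRight | loadLeft | outWire | gate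
  | look (p : Purpose)
  | back (p : Purpose) (v : Bool × Bool)
  | push (v : Bool × Bool)
  | pushBack
  | result
  | clean (acc : Bool)
  deriving DecidableEq, Fintype

/-- The registers of the verifier: the kind of the query, whether the two vertices coincide in
either of the two inputs of the circuit, and cells for letters taken from the stacks. -/
structure Reg where
  king : Bool
  eq₁ : Bool
  eq₂ : Bool
  i : Option (Bool ⊕ Bool)
  b : Option Bool
  x : Option Bool
  x' : Option Bool
  y : Option Bool
  y' : Option Bool
  p : Option (Bool × Bool)

noncomputable instance : Fintype Reg :=
  Fintype.ofInjective
    (fun r => (r.king, r.eq₁, r.eq₂, r.i, r.b, r.x, r.x', r.y, r.y', r.p)) fun r r' h => by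
      cases r; cases r'; simpa using h

/-- The registers with all cells empty. -/
abbrev reg (king eq₁ eq₂ : Bool) : Reg :=
  ⟨king, eq₁, eq₂, none, none, none, none, none, none, none⟩

namespace Reg

/-- Empty all cells. -/
def clear (r : Reg) : Reg := reg r.king r.eq₁ r.eq₂

/-- The next bits of the two vertices in the query, completed by the certificate, and the next bit
of the certificate. -/
def bits (r : Reg) : Bool × Bool × Bool :=
  (r.x.getD (r.x'.getD false), r.y.getD (r.y'.getD false), r.x'.getD false)

end Reg

/-- The bits of the first arguments of the edges to be examined. -/
def leftBits (king : Bool) (s : Bool × Bool × Bool) : Bool × Bool :=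
  if king then (s.1, s.2.2) else (s.1, s.2.1)

/-- The bits of the second arguments of the edges to be examined. -/
def rightBits (king : Bool) (s : Bool × Bool × Bool) : Bool × Bool :=
  if king then (s.2.2, s.2.1) else (s.2.1, s.1)

/-- The final decision, given the values of the circuit on the two inputs. -/
def accept (r : Reg) (v : Bool × Bool) : Bool :=
  if r.king then (r.eq₁ || v.1) && (r.eq₂ || v.2) else !r.eq₁ && (v.1 == v.2)

/-- A conjunction or a disjunction on both inputs of the circuit. -/
def binOp (conj : Bool) (u v : Bool × Bool) : Bool × Bool :=
  if conj then (u.1 && v.1, u.2 && v.2) else (u.1 || v.1, u.2 || v.2)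

/-- The control after a wire has been looked up. -/
def next : Purpose → Bool × Bool → Label
  | .neg, v => .push (!v.1, !v.2)
  | .first c, v => .look (.second c v)
  | .second c u, v => .push (binOp c u v)

/-- The letter of an input symbol. -/
def letter : Option (Bool ⊕ Bool) → Bool
  | some (.inl b) => b
  | some (.inr b) => b
  | none => false

abbrev Stm := Turing.TM2.Stmt Letter Label Reg

open Turing.TM2.Stmt

/-- A case distinction on a pair of bits. -/
def branchPair (f : Reg → Bool × Bool) (q : Bool × Bool → Stm) : Stm :=
  branch (fun r => (f r).1)
    (branch (fun r => (f r).2) (q (true, true)) (q (true, false)))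
    (branch (fun r => (f r).2) (q (false, true)) (q (false, false)))

@[simp] theorem stepAux_branchPair (f : Reg → Bool × Bool) (q : Bool × Bool → Stm) (r : Reg)
    (S : ∀ k, List (Letter k)) :
    Turing.TM2.stepAux (branchPair f q) r S = Turing.TM2.stepAux (q (f r)) r S := by
  rcases h : f r with ⟨_ | _, _ | _⟩ <;> simp [branchPair, h]

/-- Empty the cells and go on at a label. -/
def jump (l : Label) : Stm := load Reg.clear (goto fun _ => l)

/-- Move a letter of a stack of pairs to another one and repeat, until the stack is empty. -/
def moveLoop (k k' : Stack) (hk : Letter k = (Bool × Bool)) (hk' : Letter k' = (Bool × Bool))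
    (l : Label) (q : Stm) : Stm :=
  pop k (fun r p => { r with p := hk ▸ p }) <|
    branch (fun r => r.p.isSome)
      (push k' (fun r => hk'.symm ▸ r.p.getD default) <| jump l)
      q

/-- The program of the verifier. -/
def program : Label → Stm
  | .start =>
    pop .inp (fun r i => { r with i := i }) <|
      load (fun r => reg (letter r.i) r.eq₁ r.eq₂) <| goto fun _ => .parse
  | .parse =>
    pop .inp (fun r i => { r with i := i }) <|
      branch (fun r => letter r.i)
        (pop .inp (fun r i => { r with i := i }) <| push .pre (fun r => letter r.i) <| jump .parse)
        (jump .split)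
  | .split =>
    pop .inp (fun r i => { r with i := i }) <|
      branch (fun r => r.i.isSome)
        (branch (fun r => (r.i.getD (.inl false)).isLeft)
          (push .code (fun r => letter r.i) <| jump .split)
          (push .cert (fun r => letter r.i) <| jump .split))
        (jump .inputs)
  | .inputs =>
    pop .code (fun r b => { r with b := b }) <|
      branch (fun r => r.b.getD false)
        -- The code announces `n + n` inputs in unary, so one round, which treats one bit of each
        -- vertex, consumes two marks.
        (pop .code (fun r b => { r with b := b }) <|
          pop .pre (fun r b => { r with x := b }) <| pop .cert (fun r b => { r with x' := b }) <|
          pop .pre (fun r b => { r with y := b }) <| pop .cert (fun r b => { r with y' := b }) <|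
          push .aux (fun r => leftBits r.king r.bits) <|
          push .aux' (fun r => rightBits r.king r.bits) <|
          load (fun r => { r with
            eq₁ := r.eq₁ && (leftBits r.king r.bits).1 == (rightBits r.king r.bits).1
            eq₂ := r.eq₂ && (leftBits r.king r.bits).2 == (rightBits r.king r.bits).2 }) <|
          jump .inputs)
        (jump .loadRight)
  -- Moving a stack reverses it, and wire `0` has to end up on top. Hence the second argument is
  -- loaded first and the first argument on top of it.
  | .loadRight => moveLoop .aux' .wires rfl rfl .loadRight (jump .loadLeft)
  | .loadLeft => moveLoop .aux .wires rfl rfl .loadLeft (jump .outWire)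
  | .outWire =>
    pop .code (fun r b => { r with b := b }) <|
      branch (fun r => r.b.getD false) (push .out (fun _ => true) <| jump .outWire) (jump .gate)
  | .gate =>
    pop .code (fun r b => { r with b := b }) <|
      branch (fun r => r.b.isSome)
        (pop .code (fun r b => { r with x := b }) <|
          branchPair (fun r => (r.b.getD false, r.x.getD false)) fun
            | (false, false) =>
              pop .code (fun r b => { r with y := b }) <|
                branch (fun r => r.y.getD false)
                  (jump (.push (true, true))) (jump (.push (false, false)))
            | (false, true) => jump (.look .neg)
            | (true, c) => jump (.look (.first !c)))
        (jump .result)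
  | .look p =>
    pop .code (fun r b => { r with b := b }) <|
      branch (fun r => r.b.getD false)
        (moveLoop .wires .aux rfl rfl (.look p) (jump (.look p)))
        (peek .wires (fun r p => { r with p := p }) <|
          branchPair (fun r => r.p.getD default) fun v => jump (.back p v))
  | .back p v => moveLoop .aux .wires rfl rfl (.back p v) (jump (next p v))
  | .push v =>
    moveLoop .wires .aux rfl rfl (.push v) (Turing.TM2.Stmt.push .wires (fun _ => v) <| jump .pushBack)
  | .pushBack => moveLoop .aux .wires rfl rfl .pushBack (jump .gate)
  | .result =>
    pop .out (fun r b => { r with b := b }) <|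
      branch (fun r => r.b.isSome)
        (pop .wires (fun r _ => r) <| jump .result)
        (peek .wires (fun r p => { r with p := p }) <|
          branch (fun r => accept r (r.p.getD default)) (jump (.clean true)) (jump (.clean false)))
  | .clean acc =>
    pop .wires (fun r p => { r with p := p }) <| pop .pre (fun r b => { r with x := b }) <|
      pop .cert (fun r b => { r with y := b }) <|
      branch (fun r => r.p.isSome || r.x.isSome || r.y.isSome)
        (jump (.clean acc))
        (Turing.TM2.Stmt.push .out (fun _ => acc) <| load (fun _ => reg true true true) halt)

/-- The contents of the stacks. -/
def stk (I : List (Bool ⊕ Bool)) (C P W O : List Bool) (A B F : List (Bool × Bool)) :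
    ∀ k, List (Letter k)
  | .inp => I
  | .code => C
  | .pre => P
  | .cert => W
  | .out => O
  | .aux => A
  | .aux' => B
  | .wires => F

section stk

variable (I I' : List (Bool ⊕ Bool)) (C P W O L : List Bool) (A B F A' : List (Bool × Bool))

@[simp] theorem stk_inp : stk I C P W O A B F .inp = I := rfl
@[simp] theorem stk_code : stk I C P W O A B F .code = C := rfl
@[simp] theorem stk_pre : stk I C P W O A B F .pre = P := rfl
@[simp] theorem stk_cert : stk I C P W O A B F .cert = W := rfl
@[simp] theorem stk_out : stk I C P W O A B F .out = O := rfl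
@[simp] theorem stk_aux : stk I C P W O A B F .aux = A := rfl
@[simp] theorem stk_aux' : stk I C P W O A B F .aux' = B := rfl
@[simp] theorem stk_wires : stk I C P W O A B F .wires = F := rfl

@[simp] theorem update_inp :
    Function.update (stk I C P W O A B F) .inp I' = stk I' C P W O A B F := by
  funext k; cases k <;> rfl
@[simp] theorem update_code :
    Function.update (stk I C P W O A B F) .code L = stk I L P W O A B F := by
  funext k; cases k <;> rfl
@[simp] theorem update_pre :
    Function.update (stk I C P W O A B F) .pre L = stk I C L W O A B F := by
  funext k; cases k <;> rfl
@[simp] theorem update_cert :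
    Function.update (stk I C P W O A B F) .cert L = stk I C P L O A B F := by
  funext k; cases k <;> rfl
@[simp] theorem update_out :
    Function.update (stk I C P W O A B F) .out L = stk I C P W L A B F := by
  funext k; cases k <;> rfl
@[simp] theorem update_aux :
    Function.update (stk I C P W O A B F) .aux A' = stk I C P W O A' B F := by
  funext k; cases k <;> rfl
@[simp] theorem update_aux' :
    Function.update (stk I C P W O A B F) .aux' A' = stk I C P W O A A' F := by
  funext k; cases k <;> rfl
@[simp] theorem update_wires :
    Function.update (stk I C P W O A B F) .wires A' = stk I C P W O A B A' := by
  funext k; cases k <;> rfl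

end stk

abbrev Conf := Turing.TM2.Cfg Letter Label Reg

/-- Reachability for the verifier. -/
abbrev Reaches (T : ℕ) (c c' : Conf) : Prop := ReachesIn (Turing.TM2.step program) T c c'

/-! ### Loops of the verifier and the evaluation of the circuit -/

variable {I : List (Bool ⊕ Bool)} {C P W O : List Bool} {A B F : List (Bool × Bool)}
  {g e e' : Bool}

theorem reaches_loadRight (B F) :
    Reaches (B.length + 1) ⟨some .loadRight, reg g e e', stk I C P W O A B F⟩
      ⟨some .loadLeft, reg g e e', stk I C P W O A [] (B.reverse ++ F)⟩ := by
  induction B generalizing F with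
  | nil => exact .single (by simp [program, moveLoop, jump, Reg.clear])
  | cons a B ih =>
    refine .head (b := ⟨some .loadRight, reg g e e', stk I C P W O A B (a :: F)⟩) ?_ ?_
    · simp [program, moveLoop, jump, Reg.clear]
    · simpa using ih (a :: F)

theorem reaches_loadLeft (A F) :
    Reaches (A.length + 1) ⟨some .loadLeft, reg g e e', stk I C P W O A B F⟩
      ⟨some .outWire, reg g e e', stk I C P W O [] B (A.reverse ++ F)⟩ := by
  induction A generalizing F with
  | nil => exact .single (by simp [program, moveLoop, jump, Reg.clear])
  | cons a A ih =>
    refine .head (b := ⟨some .loadLeft, reg g e e', stk I C P W O A B (a :: F)⟩) ?_ ?_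
    · simp [program, moveLoop, jump, Reg.clear]
    · simpa using ih (a :: F)


theorem reaches_back (p : Purpose) (v : Bool × Bool) (A F) :
    Reaches (A.length + 1) ⟨some (.back p v), reg g e e', stk I C P W O A B F⟩
      ⟨some (next p v), reg g e e', stk I C P W O [] B (A.reverse ++ F)⟩ := by
  induction A generalizing F with
  | nil => exact .single (by simp [program, moveLoop, jump, Reg.clear])
  | cons a A ih =>
    refine .head (b := ⟨some (.back p v), reg g e e', stk I C P W O A B (a :: F)⟩) ?_ ?_
    · simp [program, moveLoop, jump, Reg.clear]
    · simpa using ih (a :: F)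

theorem reaches_pushBack (A F) :
    Reaches (A.length + 1) ⟨some .pushBack, reg g e e', stk I C P W O A B F⟩
      ⟨some .gate, reg g e e', stk I C P W O [] B (A.reverse ++ F)⟩ := by
  induction A generalizing F with
  | nil => exact .single (by simp [program, moveLoop, jump, Reg.clear])
  | cons a A ih =>
    refine .head (b := ⟨some .pushBack, reg g e e', stk I C P W O A B (a :: F)⟩) ?_ ?_
    · simp [program, moveLoop, jump, Reg.clear]
    · simpa using ih (a :: F)

theorem reaches_push_aux (v : Bool × Bool) (A F) :
    Reaches (F.length + 1) ⟨some (.push v), reg g e e', stk I C P W O A B F⟩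
      ⟨some .pushBack, reg g e e', stk I C P W O (F.reverse ++ A) B [v]⟩ := by
  induction F generalizing A with
  | nil => exact .single (by simp [program, moveLoop, jump, Reg.clear])
  | cons a F ih =>
    refine .head (b := ⟨some (.push v), reg g e e', stk I C P W O (a :: A) B F⟩) ?_ ?_
    · simp [program, moveLoop, jump, Reg.clear]
    · simpa using ih (a :: A)

/-- Wire `0` is on top, so a new wire belongs at the bottom: all values are moved away and back. -/
theorem reaches_push (v : Bool × Bool) :
    Reaches (2 * F.length + 2) ⟨some (.push v), reg g e e', stk I C P W O [] B F⟩
      ⟨some .gate, reg g e e', stk I C P W O [] B (F ++ [v])⟩ := by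
  have h := (reaches_push_aux (I := I) (C := C) (P := P) (W := W) (O := O) (B := B)
    (g := g) (e := e) (e' := e') v [] F).trans (reaches_pushBack _ _)
  simp only [List.append_nil, List.length_reverse, List.reverse_reverse] at h
  exact h.mono (by omega)

/-- Each unary mark moves one wire value to the auxiliary stack, so that after `i` marks wire `i` is
on top. The word `A.reverse ++ F` is invariant, which allows the wires to be restored afterwards. If
they run out, the marks are consumed without effect and a default is read, so the time bound holds
for ill-formed code too. -/
theorem reaches_look_aux (p : Purpose) (C A F) :
    ∃ C' v A' F', C'.length ≤ C.length ∧ A'.reverse ++ F' = A.reverse ++ F ∧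
      Reaches (C.length + 1) ⟨some (.look p), reg g e e', stk I C P W O A B F⟩
        ⟨some (.back p v), reg g e e', stk I C' P W O A' B F'⟩ ∧
      ∀ i rest, C = unaryCode i ++ rest → C' = rest ∧ v = F.getD i default := by
  induction C generalizing A F with
  | nil =>
    refine ⟨[], F.head?.getD default, A, F, le_rfl, rfl, .single ?_, ?_⟩
    · simp [program, moveLoop, jump, Reg.clear]
    · simp [unaryCode]
  | cons c C ih =>
    cases c with
    | false =>
      refine ⟨C, F.head?.getD default, A, F, by simp, rfl, (ReachesIn.single ?_).mono (by simp), ?_⟩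
      · simp [program, moveLoop, jump, Reg.clear]
      · rintro (_ | i) rest h
        · simp only [unaryCode, List.replicate_zero, List.nil_append, List.cons_append,
            List.cons.injEq, true_and] at h
          exact ⟨h, by cases F <;> rfl⟩
        · simp [unaryCode, List.replicate_succ] at h
    | true =>
      cases F with
      | nil =>
        obtain ⟨C', v, A', F', h₁, h₂, h₃, h₄⟩ := ih A []
        refine ⟨C', v, A', F', h₁.trans (by simp), h₂, .head ?_ h₃, ?_⟩
        · simp [program, moveLoop, jump, Reg.clear]
        · rintro (_ | i) rest h
          · simp [unaryCode] at h
          · obtain ⟨rfl, rfl⟩ := h₄ i rest (by simpa [unaryCode, List.replicate_succ] using h)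
            simp
      | cons a F =>
        obtain ⟨C', v, A', F', h₁, h₂, h₃, h₄⟩ := ih (a :: A) F
        refine ⟨C', v, A', F', h₁.trans (by simp), by simpa using h₂, .head ?_ h₃, ?_⟩
        · simp [program, moveLoop, jump, Reg.clear]
        · rintro (_ | i) rest h
          · simp [unaryCode] at h
          · obtain ⟨rfl, rfl⟩ := h₄ i rest (by simpa [unaryCode, List.replicate_succ] using h)
            simp

theorem reaches_look (p : Purpose) (C F) :
    ∃ C' v, C'.length ≤ C.length ∧
      Reaches (C.length + F.length + 2) ⟨some (.look p), reg g e e', stk I C P W O [] B F⟩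
        ⟨some (next p v), reg g e e', stk I C' P W O [] B F⟩ ∧
      ∀ i rest, C = unaryCode i ++ rest → C' = rest ∧ v = F.getD i default := by
  obtain ⟨C', v, A', F', h₁, h₂, h₃, h₄⟩ := reaches_look_aux (I := I) (P := P) (W := W) (O := O)
    (B := B) (g := g) (e := e) (e' := e') p C [] F
  have h := h₃.trans (reaches_back p v A' F')
  have hl := congrArg List.length h₂
  simp only [List.reverse_nil, List.nil_append] at h₂
  rw [h₂] at h
  simp at hl
  exact ⟨C', v, h₁, h.mono (by omega), h₄⟩

/-- The values of a gate on two inputs of the circuit. -/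
def pairEval (F : List (Bool × Bool)) (G : BoolGate) : Bool × Bool :=
  (G.eval (F.map Prod.fst), G.eval (F.map Prod.snd))

theorem getD_map_fst (F : List (Bool × Bool)) (i : ℕ) :
    (F.map Prod.fst).getD i false = (F.getD i default).1 := by
  simp only [List.getD_eq_getElem?_getD, List.getElem?_map]
  cases F[i]? <;> rfl

theorem getD_map_snd (F : List (Bool × Bool)) (i : ℕ) :
    (F.map Prod.snd).getD i false = (F.getD i default).2 := by
  simp only [List.getD_eq_getElem?_getD, List.getElem?_map]
  cases F[i]? <;> rfl

/-- The worst case is a binary gate: one step for its kind, two lookups of at most `C.length +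
F.length + 2` steps, and `2 * F.length + 2` steps for appending the value. Truncated code is
completed by default values. -/
theorem reaches_gate_step (c : Bool) (C F) :
    ∃ C' v, C'.length ≤ C.length ∧
      Reaches (2 * C.length + 4 * F.length + 7)
        ⟨some .gate, reg g e e', stk I (c :: C) P W O [] B F⟩
        ⟨some .gate, reg g e e', stk I C' P W O [] B (F ++ [v])⟩ ∧
      ∀ G rest, c :: C = BoolGate.encode G ++ rest → C' = rest ∧ v = pairEval F G := by
  rcases c with _ | _
  · rcases C with _ | ⟨c, C⟩
    · refine ⟨[], (false, false), le_rfl,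
        (ReachesIn.head ?_ (reaches_push _)).mono (by simp; omega), ?_⟩
      · simp [program, jump, Reg.clear]
      · rintro (_ | _ | _ | _) rest h <;> simp [BoolGate.encode] at h
    rcases c with _ | _
    · refine ⟨C.tail, (C.head?.getD false, C.head?.getD false), by simp; omega,
        (ReachesIn.head ?_ (reaches_push _)).mono (by simp; omega), ?_⟩
      · rcases C with _ | ⟨_ | _, C⟩ <;> simp [program, jump, Reg.clear]
      · rintro (_ | _ | _ | _) rest h <;> simp [BoolGate.encode] at h
        simp [h, pairEval, BoolGate.eval]
    · obtain ⟨C', v, h₁, h₂, h₃⟩ := reaches_look (I := I) (P := P) (W := W) (O := O)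
        (B := B) (g := g) (e := e) (e' := e') .neg C F
      refine ⟨C', (!v.1, !v.2), h₁.trans (by simp),
        (ReachesIn.head ?_ (h₂.trans (reaches_push _))).mono (by simp; omega), ?_⟩
      · simp [program, jump, Reg.clear]
      · rintro (_ | i | _ | _) rest h <;> simp [BoolGate.encode] at h
        obtain ⟨rfl, rfl⟩ := h₃ i rest h
        simp only [pairEval, BoolGate.eval, getD_map_fst, getD_map_snd, true_and]
  · obtain ⟨C₁, u, h₁, h₂, h₃⟩ := reaches_look (I := I) (P := P) (W := W) (O := O)
        (B := B) (g := g) (e := e) (e' := e') (.first !(C.head?.getD false)) C.tail F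
    obtain ⟨C', v, h₄, h₅, h₆⟩ := reaches_look (I := I) (P := P) (W := W) (O := O)
        (B := B) (g := g) (e := e) (e' := e') (.second (!(C.head?.getD false)) u) C₁ F
    have hC : C.tail.length ≤ C.length := by simp
    refine ⟨C', binOp (!(C.head?.getD false)) u v, by omega,
      (ReachesIn.head ?_ (h₂.trans (h₅.trans (reaches_push _)))).mono (by omega), ?_⟩
    · rcases C with _ | ⟨_ | _, C⟩ <;> simp [program, jump, Reg.clear]
    · rintro (_ | _ | ⟨i, j⟩ | ⟨i, j⟩) rest h <;> simp [BoolGate.encode] at h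
      all_goals
        subst h
        obtain ⟨rfl, rfl⟩ := h₃ i (unaryCode j ++ rest) (by simp)
        obtain ⟨rfl, rfl⟩ := h₆ j rest rfl
        simp only [pairEval, BoolGate.eval, getD_map_fst, getD_map_snd, binOp, List.head?_cons,
          Option.getD_some, true_and]
        rfl

/-- A gate consumes at least one letter of the code and adds one wire, so `C.length + F.length`
never grows. There are at most `C.length` rounds, each of time linear in this sum. -/
theorem reaches_gates (C F) :
    ∃ F', F'.length ≤ F.length + C.length ∧
      Reaches (C.length * (4 * (C.length + F.length) + 7) + 1)
        ⟨some .gate, reg g e e', stk I C P W O [] B F⟩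
        ⟨some .result, reg g e e', stk I [] P W O [] B F'⟩ ∧
      ∀ Gs : List BoolGate, C = Gs.flatMap BoolGate.encode →
        F' = Gs.foldl (fun w G => w ++ [pairEval w G]) F := by
  induction hn : C.length using Nat.strong_induction_on generalizing C F with
  | _ n ih =>
    subst hn
    rcases C with _ | ⟨c, C⟩
    · refine ⟨F, by simp, (ReachesIn.single ?_).mono (by simp), ?_⟩
      · simp [program, jump, Reg.clear]
      · rintro (_ | ⟨_ | _ | _ | _, Gs⟩) h <;> simp [BoolGate.encode] at h ⊢
    · obtain ⟨C', v, h₁, h₂, h₃⟩ := reaches_gate_step (I := I) (P := P) (W := W) (O := O)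
        (B := B) (g := g) (e := e) (e' := e') c C F
      obtain ⟨F', h₄, h₅, h₆⟩ := ih C'.length (by simp; omega) C' (F ++ [v]) rfl
      simp only [List.length_append, List.length_cons, List.length_nil] at h₄
      refine ⟨F', by simp; omega, (h₂.trans h₅).mono ?_, ?_⟩
      · simp only [List.length_append, List.length_cons, List.length_nil]
        nlinarith [Nat.mul_le_mul h₁ (show 4 * (C'.length + (F.length + (0 + 1))) + 7 ≤
          4 * (C.length + 1 + F.length) + 7 by omega)]
      · rintro (_ | ⟨G, Gs⟩) h
        · simp at h
        · obtain ⟨rfl, rfl⟩ := h₃ G (Gs.flatMap BoolGate.encode) (by simpa using h)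
          exact h₆ Gs rfl

theorem reaches_outWire (C O) :
    ∃ C' O', C'.length ≤ C.length ∧ O'.length ≤ O.length + C.length ∧
      Reaches (C.length + 1) ⟨some .outWire, reg g e e', stk I C P W O A B F⟩
        ⟨some .gate, reg g e e', stk I C' P W O' A B F⟩ ∧
      ∀ i rest, C = unaryCode i ++ rest → C' = rest ∧ O'.length = O.length + i := by
  induction C generalizing O with
  | nil =>
    refine ⟨[], O, le_rfl, by simp, .single ?_, ?_⟩
    · simp [program, jump, Reg.clear]
    · simp [unaryCode]
  | cons c C ih =>
    cases c with
    | false =>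
      refine ⟨C, O, by simp, by simp, (ReachesIn.single ?_).mono (by simp), ?_⟩
      · simp [program, jump, Reg.clear]
      · rintro (_ | i) rest h
        · simpa [unaryCode] using h
        · simp [unaryCode, List.replicate_succ] at h
    | true =>
      obtain ⟨C', O', h₁, h₂, h₃, h₄⟩ := ih (true :: O)
      simp only [List.length_cons] at h₂
      refine ⟨C', O', h₁.trans (by simp), by simp; omega, .head ?_ h₃, ?_⟩
      · simp [program, jump, Reg.clear]
      · rintro (_ | i) rest h
        · simp [unaryCode] at h
        · obtain ⟨rfl, h'⟩ := h₄ i rest (by simpa [unaryCode, List.replicate_succ] using h)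
          refine ⟨rfl, h'.trans ?_⟩
          simp; omega

theorem reaches_result (O F) :
    Reaches (O.length + 1) ⟨some .result, reg g e e', stk I C P W O A B F⟩
      ⟨some (.clean (accept (reg g e e') (F.getD O.length default))), reg g e e',
        stk I C P W [] A B (F.drop O.length)⟩ := by
  induction O generalizing F with
  | nil =>
    refine .single ?_
    have h : F.getD 0 default = F.head?.getD default := by cases F <;> rfl
    simp only [List.length_nil, h]
    simp only [program, jump, Turing.TM2.step, Turing.TM2.stepAux, stk_out, stk_wires, update_out,
      List.head?_nil, Option.isSome_none, cond_false, List.tail_nil, List.drop_zero]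
    change some (bif accept (reg g e e') (F.head?.getD default) then _ else _) = _
    cases accept (reg g e e') (F.head?.getD default) <;> rfl
  | cons o O ih =>
    refine .head (b := ⟨some .result, reg g e e', stk I C P W O A B F.tail⟩) ?_ ?_
    · simp [program, jump, Reg.clear]
    · have := ih F.tail
      cases F <;> simpa using this

/-- The halting configuration of the verifier. -/
def halted (acc : Bool) : Conf := ⟨none, reg true true true, stk [] [] [] [] [acc] [] [] []⟩

/-- `Turing.haltList` requires that all stacks but the output be empty and the registers be in their
initial state. The three stacks that may be nonempty are emptied in parallel. -/
theorem reaches_clean (acc : Bool) (T : ℕ) (P W F) (hP : P.length ≤ T) (hW : W.length ≤ T)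
    (hF : F.length ≤ T) :
    Reaches (T + 1) ⟨some (.clean acc), reg g e e', stk [] [] P W [] [] [] F⟩ (halted acc) := by
  induction T generalizing P W F with
  | zero =>
    obtain rfl := List.eq_nil_of_length_eq_zero (Nat.le_zero.1 hP)
    obtain rfl := List.eq_nil_of_length_eq_zero (Nat.le_zero.1 hW)
    obtain rfl := List.eq_nil_of_length_eq_zero (Nat.le_zero.1 hF)
    exact .single (by simp [program, halted])
  | succ T ih =>
    by_cases h : P = [] ∧ W = [] ∧ F = []
    · obtain ⟨rfl, rfl, rfl⟩ := h
      exact (ReachesIn.single (by simp [program, halted])).mono (by omega)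
    · refine .head ?_ (ih P.tail W.tail F.tail (by simp; omega) (by simp; omega) (by simp; omega))
      rcases P with _ | ⟨p, P⟩ <;> rcases W with _ | ⟨w, W⟩ <;> rcases F with _ | ⟨f, F⟩ <;>
        simp [program, jump, Reg.clear] at h ⊢

/-! ### Decoding of a query and its certificate -/

theorem reaches_parse (I P) :
    ∃ I' P', I'.length + P'.length ≤ I.length + P.length ∧
      Reaches (I.length + 1) ⟨some .parse, reg g e e', stk I C P W O A B F⟩
        ⟨some .split, reg g e e', stk I' C P' W O A B F⟩ ∧
      ∀ (d : List Bool) (rest : List (Bool ⊕ Bool)),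
        I = d.flatMap (fun b => [.inl true, .inl b]) ++ .inl false :: rest →
          I' = rest ∧ P' = d.reverse ++ P := by
  induction hn : I.length using Nat.strong_induction_on generalizing I P with
  | _ n ih =>
    subst hn
    by_cases hI : letter I.head? = true
    · obtain ⟨I', P', h₁, h₂, h₃⟩ := ih I.tail.tail.length
        (by cases I with
          | nil => cases hI
          | cons a I => simp) I.tail.tail (letter I.tail.head? :: P) rfl
      have hI' : I.tail.tail.length + 1 ≤ I.length := by
        cases I with
        | nil => cases hI
        | cons a I => simp
      simp only [List.length_cons] at h₁
      refine ⟨I', P', ?_, (ReachesIn.head ?_ h₂).mono (by omega), ?_⟩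
      · simp at h₁; omega
      · simp [program, jump, Reg.clear, hI]
      · rintro (_ | ⟨b, d⟩) rest rfl
        · simp [letter] at hI
        · obtain ⟨rfl, rfl⟩ := h₃ d rest (by simp)
          simp [letter]
    · refine ⟨I.tail, P, by simp, (ReachesIn.single ?_).mono (by omega), ?_⟩
      · simp [program, jump, Reg.clear, hI]
      · rintro (_ | ⟨b, d⟩) rest rfl
        · simp
        · simp [letter] at hI

theorem reaches_split (I C W) :
    ∃ C' W', C'.length + W'.length ≤ I.length + C.length + W.length ∧
      Reaches (I.length + 1) ⟨some .split, reg g e e', stk I C P W O A B F⟩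
        ⟨some .inputs, reg g e e', stk [] C' P W' O A B F⟩ ∧
      ∀ c w : List Bool, I = c.map .inl ++ w.map .inr →
        C' = c.reverse ++ C ∧ W' = w.reverse ++ W := by
  induction I generalizing C W with
  | nil =>
    refine ⟨C, W, by simp, .single ?_, fun c w h => ?_⟩
    · simp [program, jump, Reg.clear]
    · obtain ⟨rfl, rfl⟩ : c = [] ∧ w = [] := by simpa using h
      simp
  | cons a I ih =>
    rcases a with a | a
    · obtain ⟨C', W', h₁, h₂, h₃⟩ := ih (a :: C) W
      simp only [List.length_cons] at h₁
      refine ⟨C', W', by simp; omega, .head ?_ h₂, fun c w h => ?_⟩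
      · simp [program, jump, Reg.clear, letter]
      · rcases c with _ | ⟨b, c⟩
        · rcases w with _ | ⟨b, w⟩ <;> simp at h
        · simp only [List.map_cons, List.cons_append, List.cons.injEq, Sum.inl.injEq] at h
          obtain ⟨rfl, rfl⟩ := h₃ c w h.2
          simp [h.1]
    · obtain ⟨C', W', h₁, h₂, h₃⟩ := ih C (a :: W)
      simp only [List.length_cons] at h₁
      refine ⟨C', W', by simp; omega, .head ?_ h₂, fun c w h => ?_⟩
      · simp [program, jump, Reg.clear, letter]
      · rcases c with _ | ⟨b, c⟩
        · rcases w with _ | ⟨b, w⟩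
          · simp at h
          · simp only [List.map_nil, List.map_cons, List.nil_append, List.cons.injEq,
              Sum.inr.injEq] at h
            obtain ⟨rfl, rfl⟩ := h₃ [] w (by simpa using h.2)
            simp [h.1]
        · simp at h

/-- The bits of the two vertices in the query, completed by the certificate, and those bits of the
certificate that stand at the places of the first vertex. -/
def readBits : ℕ → List Bool → List Bool → List (Bool × Bool × Bool)
  | 0, _, _ => []
  | n + 1, P, W =>
    (P.head?.getD (W.head?.getD false), P.tail.head?.getD (W.tail.head?.getD false),
      W.head?.getD false) :: readBits n P.tail.tail W.tail.tail

/-- The arguments of the first edge coincide. -/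
def same₁ (g : Bool) (ss : List (Bool × Bool × Bool)) : Bool :=
  ss.all fun s => (leftBits g s).1 == (rightBits g s).1

/-- The arguments of the second edge coincide. -/
def same₂ (g : Bool) (ss : List (Bool × Bool × Bool)) : Bool :=
  ss.all fun s => (leftBits g s).2 == (rightBits g s).2

theorem reaches_inputs (C P W A B) (e e' : Bool) :
    ∃ C' P' W' A' B' d d', C'.length ≤ C.length ∧ P'.length ≤ P.length ∧ W'.length ≤ W.length ∧
      A'.length ≤ A.length + C.length ∧ B'.length ≤ B.length + C.length ∧
      Reaches (C.length + 1) ⟨some .inputs, reg g e e', stk I C P W O A B F⟩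
        ⟨some .loadRight, reg g d d', stk I C' P' W' O A' B' F⟩ ∧
      ∀ n rest, C = unaryCode (n + n) ++ rest →
        C' = rest ∧ A' = ((readBits n P W).map (leftBits g)).reverse ++ A ∧
          B' = ((readBits n P W).map (rightBits g)).reverse ++ B ∧
          d = (e && same₁ g (readBits n P W)) ∧ d' = (e' && same₂ g (readBits n P W)) := by
  induction hn : C.length using Nat.strong_induction_on generalizing C P W A B e e' with
  | _ n ih =>
    subst hn
    rcases C with _ | ⟨c, C⟩
    · refine ⟨[], P, W, A, B, e, e', by simp, by simp, by simp, by simp, by simp, .single ?_, ?_⟩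
      · simp [program, jump, Reg.clear]
      · simp [unaryCode]
    · rcases c with _ | _
      · refine ⟨C, P, W, A, B, e, e', by simp, by simp, by simp, by simp, by simp,
          (ReachesIn.single ?_).mono (by simp), ?_⟩
        · simp [program, jump, Reg.clear]
        · rintro (_ | n) rest h
          · simpa [unaryCode, readBits, same₁, same₂] using h
          · simp [unaryCode, ← Nat.add_assoc, List.replicate_succ] at h
      · set s : Bool × Bool × Bool :=
          (P.head?.getD (W.head?.getD false), P.tail.head?.getD (W.tail.head?.getD false),
            W.head?.getD false) with hs
        obtain ⟨C', P', W', A', B', d, d', h₁, h₂, h₃, h₄, h₅, h₆, h₇⟩ := ih C.tail.length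
          (by simp) C.tail P.tail.tail W.tail.tail (leftBits g s :: A) (rightBits g s :: B)
          (e && (leftBits g s).1 == (rightBits g s).1)
          (e' && (leftBits g s).2 == (rightBits g s).2) rfl
        simp only [List.length_cons, List.length_tail] at h₁ h₂ h₃ h₄ h₅ h₆
        by_cases hC : C = []
        · subst hC
          simp only [List.length_nil] at h₁ h₂ h₃ h₄ h₅ h₆
          refine ⟨C', P', W', A', B', d, d', by simp; omega, by omega, by omega, by simp; omega,
            by simp; omega, (ReachesIn.head ?_ h₆).mono (by simp), ?_⟩
          · simp [program, jump, Reg.clear, Reg.bits, hs]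
          · rintro (_ | n) rest h <;>
              simp [unaryCode, ← Nat.add_assoc, List.replicate_succ] at h
        · have hC' := List.length_pos_of_ne_nil hC
          refine ⟨C', P', W', A', B', d, d', by simp; omega, by omega, by omega, by simp; omega,
            by simp; omega, (ReachesIn.head ?_ h₆).mono (by simp), ?_⟩
          · simp [program, jump, Reg.clear, Reg.bits, hs]
          · rintro (_ | n) rest h
            · simp [unaryCode] at h
            · have h' : C.tail = unaryCode (n + n) ++ rest := by
                rw [show n + 1 + (n + 1) = n + n + 1 + 1 by omega] at h
                simp only [unaryCode, List.replicate_succ, List.cons_append, List.cons.injEq] at h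
                rw [h.2]; simp [unaryCode]
              obtain ⟨rfl, rfl, rfl, rfl, rfl⟩ := h₇ n rest h'
              simp [readBits, same₁, same₂, hs, Bool.and_assoc]

/-! ### Well-formed queries and membership of the oracle in NP -/

/-- The code of a circuit with `n + n` inputs. -/
def circuitCode (n : ℕ) (Gs : List BoolGate) (out : ℕ) : List Bool :=
  unaryCode (n + n) ++ unaryCode out ++ Gs.flatMap BoolGate.encode

/-- The word for the query of kind `g` on the bits `d`, in reverse order. -/
def queryCode (g : Bool) (d c : List Bool) : List Bool :=
  g :: (d.flatMap (fun b => [true, b]) ++ false :: c.reverse)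

/-- The decision of the verifier on a well-formed query. -/
def verdict (g : Bool) (Gs : List BoolGate) (out : ℕ) (ss : List (Bool × Bool × Bool)) : Bool :=
  accept (reg g (same₁ g ss) (same₂ g ss))
    ((Gs.foldl (fun w G => w ++ [pairEval w G])
      (ss.map (leftBits g) ++ ss.map (rightBits g))).getD out default)

/-- Halting on every input is what makes `verify` a total function; its values matter only on
well-formed queries, which the second clause describes. -/
theorem reaches_halted (x w : List Bool) :
    ∃ acc, Reaches (12 * (x.length + w.length) ^ 2 + 20 * (x.length + w.length) + 20)
        ⟨some .start, reg true true true, stk (encodeStringPair (x, w)) [] [] [] [] [] [] []⟩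
        (halted acc) ∧
      ∀ g d n Gs out, x = queryCode g d (circuitCode n Gs out) →
        acc = verdict g Gs out (readBits n d.reverse w.reverse) := by
  set J := encodeStringPair (x, w) with hJ
  set N := x.length + w.length with hN
  have hJN : J.length = N := by simp [hJ, encodeStringPair, hN]
  have h₀ : Reaches 1 ⟨some .start, reg true true true, stk J [] [] [] [] [] [] []⟩
      ⟨some .parse, reg (letter J.head?) true true, stk J.tail [] [] [] [] [] [] []⟩ :=
    .single (by simp [program])
  generalize hg : letter J.head? = g at h₀
  have ht : J.tail.length ≤ J.length := by simp
  obtain ⟨I, P, h₁, h₂, h₃⟩ := reaches_parse (C := []) (W := []) (O := []) (A := []) (B := [])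
    (F := []) (g := g) (e := true) (e' := true) J.tail []
  obtain ⟨C, W, h₄, h₅, h₆⟩ := reaches_split (P := P) (O := []) (A := []) (B := [])
    (F := []) (g := g) (e := true) (e' := true) I [] []
  obtain ⟨C', P', W', A, B, e, e', h₇, h₈, h₉, h₁₀, h₁₁, h₁₂, h₁₃⟩ := reaches_inputs
    (I := []) (O := []) (F := []) (g := g) C P W [] [] true true
  have h₁₄ := (reaches_loadRight (I := []) (C := C') (P := P') (W := W') (O := []) (A := A)
    (g := g) (e := e) (e' := e') B []).trans (reaches_loadLeft A _)
  obtain ⟨D, O, h₁₅, h₁₆, h₁₇, h₁₈⟩ := reaches_outWire (I := []) (P := P') (W := W')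
    (A := []) (B := []) (F := A.reverse ++ (B.reverse ++ [])) (g := g) (e := e) (e' := e') C' []
  obtain ⟨F, h₁₉, h₂₀, h₂₁⟩ := reaches_gates (I := []) (P := P') (W := W') (O := O)
    (B := []) (g := g) (e := e) (e' := e') D (A.reverse ++ (B.reverse ++ []))
  simp only [List.length_nil, List.length_append, List.length_reverse, Nat.add_zero, Nat.zero_add]
    at *
  refine ⟨accept (reg g e e') (F.getD O.length default),
    (h₀.trans <| h₂.trans <| h₅.trans <| h₁₂.trans <| h₁₄.trans <| h₁₇.trans <| h₂₀.trans <|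
      (reaches_result O F).trans <|
      -- The wires are the two loaded arguments and at most one wire per remaining letter of the
      -- code, each part being of length at most `N`.
      reaches_clean _ (3 * N) P' W' _ (by omega) (by omega) (by simp; omega)).mono ?_, ?_⟩
  · have : D.length * (4 * (D.length + (A.length + B.length)) + 7) ≤ N * (4 * (N + (N + N)) + 7) :=
      Nat.mul_le_mul (by omega) (by omega)
    have : N * (4 * (N + (N + N)) + 7) = 12 * N ^ 2 + 7 * N := by ring
    omega
  · rintro g' d n Gs out rfl
    have hJ' : J = .inl g' :: (d.flatMap (fun b => [.inl true, .inl b]) ++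
        .inl false :: ((circuitCode n Gs out).reverse.map .inl ++ w.map .inr)) := by
      rw [hJ]
      simp [encodeStringPair, queryCode, List.map_flatMap]
    obtain rfl : g' = g := by rw [← hg, hJ']; rfl
    obtain ⟨rfl, rfl⟩ := h₃ d _ (by rw [hJ']; rfl)
    obtain ⟨rfl, rfl⟩ := h₆ _ _ rfl
    obtain ⟨rfl, rfl, rfl, rfl, rfl⟩ := h₁₃ n (unaryCode out ++ Gs.flatMap BoolGate.encode)
      (by simp [circuitCode])
    obtain ⟨rfl, hO⟩ := h₁₈ out _ rfl
    obtain rfl := h₂₁ Gs rfl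
    rw [hO]
    simp [verdict]

/-- The verifier as a bundled machine. -/
noncomputable def machine : Turing.FinTM2 where
  K := Stack
  k₀ := .inp
  k₁ := .out
  Γ := Letter
  Λ := Label
  main := .start
  σ := Reg
  initialState := reg true true true
  Γk₀Fin := inferInstanceAs (Fintype (Bool ⊕ Bool))
  m := program

/-- The function computed by the verifier. -/
noncomputable def verify (z : List Bool × List Bool) : Bool :=
  (reaches_halted z.1 z.2).choose

theorem verify_queryCode (g : Bool) (d : List Bool) (n : ℕ) (Gs : List BoolGate) (out : ℕ)
    (w : List Bool) :
    verify (queryCode g d (circuitCode n Gs out), w) =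
      verdict g Gs out (readBits n d.reverse w.reverse) :=
  (reaches_halted _ w).choose_spec.2 g d n Gs out rfl

theorem nonempty_computable :
    Nonempty (Turing.TM2ComputableInPolyTime encodeStringPair Computability.encodeBool verify) := by
  refine ⟨{
    tm := machine
    inputAlphabet := Equiv.refl (Bool ⊕ Bool)
    outputAlphabet := Equiv.refl Bool
    time := 12 * Polynomial.X ^ 2 + 20 * Polynomial.X + 20
    outputsFun := fun z => Classical.choice ?_ }⟩
  obtain ⟨t, ht, h⟩ := (reaches_halted z.1 z.2).choose_spec.1
  have e₁ : (Turing.initList machine ((encodeStringPair z).map (Equiv.refl (Bool ⊕ Bool)).invFun) :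
      Conf) =
      ⟨some .start, reg true true true, stk (encodeStringPair z) [] [] [] [] [] [] []⟩ := by
    refine congrArg (Turing.TM2.Cfg.mk _ _) (funext fun k => ?_)
    cases k <;> first | rfl | exact List.map_id _
  have e₂ : (Turing.haltList machine
      ((Computability.encodeBool (verify z)).map (Equiv.refl Bool).invFun) : Conf) =
      halted (verify z) := by
    refine congrArg (Turing.TM2.Cfg.mk _ _) (funext fun k => ?_)
    cases k <;> rfl
  refine ⟨⟨⟨t, ?_⟩, ?_⟩⟩
  · exact (congrArg (fun c => (flip bind (Turing.TM2.step program))^[t] (some c)) e₁).trans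
      (h.trans (congrArg some e₂.symm))
  · have : (encodeStringPair z).length = z.1.length + z.2.length := by simp [encodeStringPair]
    simpa [this] using ht

/-- The oracle: the queries that have a short certificate. -/
def oracle : Set (List Bool) := {x | ∃ w : List Bool, w.length ≤ x.length ∧ verify (x, w) = true}

theorem inNP_oracle : InNP oracle :=
  ⟨verify, Polynomial.X, nonempty_computable, fun x => by simp [oracle]⟩

/-! ### The meaning of the two kinds of queries -/

/-- The output of a circuit on a list of input bits. -/
def evalList (Gs : List BoolGate) (out : ℕ) (l : List Bool) : Bool :=
  (Gs.foldl (fun w G => w ++ [G.eval w]) l).getD out false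

/-- The two simultaneous evaluations never interact, so projecting commutes with each gate. -/
theorem map_fst_foldl (Gs : List BoolGate) (F : List (Bool × Bool)) :
    (Gs.foldl (fun w G => w ++ [pairEval w G]) F).map Prod.fst =
      Gs.foldl (fun w G => w ++ [G.eval w]) (F.map Prod.fst) := by
  induction Gs generalizing F with
  | nil => rfl
  | cons G Gs ih =>
    rw [List.foldl_cons, ih]
    simp [pairEval]

theorem map_snd_foldl (Gs : List BoolGate) (F : List (Bool × Bool)) :
    (Gs.foldl (fun w G => w ++ [pairEval w G]) F).map Prod.snd =
      Gs.foldl (fun w G => w ++ [G.eval w]) (F.map Prod.snd) := by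
  induction Gs generalizing F with
  | nil => rfl
  | cons G Gs ih =>
    rw [List.foldl_cons, ih]
    simp [pairEval]

theorem verdict_eq (g : Bool) (Gs : List BoolGate) (out : ℕ) (ss : List (Bool × Bool × Bool)) :
    verdict g Gs out ss = accept (reg g (same₁ g ss) (same₂ g ss))
      (evalList Gs out (ss.map (fun s => (leftBits g s).1) ++ ss.map (fun s => (rightBits g s).1)),
        evalList Gs out
          (ss.map (fun s => (leftBits g s).2) ++ ss.map (fun s => (rightBits g s).2))) := by
  unfold verdict evalList
  congr 1
  ext1
  · rw [← getD_map_fst, map_fst_foldl]; simp [Function.comp_def]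
  · rw [← getD_map_snd, map_snd_foldl]; simp [Function.comp_def]

/-- The bits of a list of pairs. -/
def interleave (zs : List (Bool × Bool)) : List Bool := zs.flatMap fun z => [z.1, z.2]

/-- A pair of distinct vertices, given by the list of the pairs of their bits, which violates the
tournament property of the edge relation `E`. -/
def Violates (E : List Bool → List Bool → Bool) (zs : List (Bool × Bool)) : Prop :=
  zs.map Prod.fst ≠ zs.map Prod.snd ∧
    E (zs.map Prod.fst) (zs.map Prod.snd) = E (zs.map Prod.snd) (zs.map Prod.fst)

theorem all_beq (f h : Bool × Bool × Bool → Bool) (ss : List (Bool × Bool × Bool)) :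
    (ss.all fun s => f s == h s) = decide (ss.map f = ss.map h) := by
  induction ss with
  | nil => rfl
  | cons s ss ih =>
    rw [List.all_cons, ih]
    simp [-List.map_inj_left, Bool.beq_eq_decide_eq]

theorem verdict_false (Gs : List BoolGate) (out : ℕ) (ss : List (Bool × Bool × Bool)) :
    verdict false Gs out ss = true ↔
      Violates (fun x y => evalList Gs out (x ++ y)) (ss.map fun s => (s.1, s.2.1)) := by
  rw [verdict_eq, same₁, same₂, all_beq, all_beq]
  simp [-List.map_inj_left, accept, leftBits, rightBits, Violates, Function.comp_def]

theorem verdict_true (Gs : List BoolGate) (out : ℕ) (ss : List (Bool × Bool × Bool)) :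
    verdict true Gs out ss = true ↔
      (ss.map (fun s => s.1) = ss.map (fun s => s.2.2) ∨
        evalList Gs out (ss.map (fun s => s.1) ++ ss.map (fun s => s.2.2)) = true) ∧
      (ss.map (fun s => s.2.2) = ss.map (fun s => s.2.1) ∨
        evalList Gs out (ss.map (fun s => s.2.2) ++ ss.map (fun s => s.2.1)) = true) := by
  rw [verdict_eq, same₁, same₂, all_beq, all_beq]
  simp [accept, leftBits, rightBits]

@[simp] theorem length_readBits (n : ℕ) (P W : List Bool) : (readBits n P W).length = n := by
  induction n generalizing P W with
  | zero => rfl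
  | succ n ih => simp [readBits, ih]

@[simp] theorem interleave_nil : interleave [] = [] := rfl

@[simp] theorem interleave_cons (z : Bool × Bool) (zs : List (Bool × Bool)) :
    interleave (z :: zs) = z.1 :: z.2 :: interleave zs := rfl

@[simp] theorem length_interleave (zs : List (Bool × Bool)) :
    (interleave zs).length = 2 * zs.length := by
  induction zs with
  | nil => rfl
  | cons z zs ih => simp [ih]; omega

/-- Bits of the query take precedence over those of the certificate, so no certificate can change
the prefix. -/
theorem prefix_readBits (n : ℕ) (P W : List Bool) (hP : P.length ≤ 2 * n) :
    P <+: interleave ((readBits n P W).map fun s => (s.1, s.2.1)) := by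
  induction n generalizing P W with
  | zero => simp at hP; simp [hP]
  | succ n ih =>
    rcases P with _ | ⟨x, _ | ⟨y, P⟩⟩
    · simp
    · simp [readBits]
    · simpa [readBits] using ih P W.tail.tail (by simp at hP; omega)

theorem readBits_of_prefix (P : List Bool) (zs : List (Bool × Bool)) (h : P <+: interleave zs) :
    (readBits zs.length P (interleave zs)).map (fun s => (s.1, s.2.1)) = zs := by
  induction zs generalizing P with
  | nil => rfl
  | cons z zs ih =>
    rcases P with _ | ⟨x, _ | ⟨y, P⟩⟩
    · simpa [readBits] using ih [] (by simp)
    · have := ih [] (by simp)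
      simp_all [readBits]
    · have := ih P
      simp_all [readBits]

theorem readBits_interleave (zs : List (Bool × Bool)) (W : List Bool) :
    (readBits zs.length (interleave zs) W).map (fun s => (s.1, s.2.1)) = zs := by
  induction zs generalizing W with
  | nil => rfl
  | cons z zs ih => simp [readBits, ih]

/-- Only every second bit of a certificate counts for the middle vertex; doubling each bit puts it
at its place. -/
theorem readBits_cert (P bs : List Bool) :
    (readBits bs.length P (interleave (bs.map fun b => (b, b)))).map (fun s => s.2.2) = bs := by
  induction bs generalizing P with
  | nil => rfl
  | cons b bs ih => simp [readBits, ih]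

/-- A query contains `n + n` in unary, so a certificate of `2 * n` bits respects the length bound in
`oracle`. -/
theorem le_length_queryCode (g : Bool) (d : List Bool) (n : ℕ) (Gs : List BoolGate) (out : ℕ) :
    2 * n ≤ (queryCode g d (circuitCode n Gs out)).length := by
  simp [queryCode, circuitCode, unaryCode]; omega

theorem mem_oracle_false (n : ℕ) (Gs : List BoolGate) (out : ℕ) (p : List Bool)
    (hp : p.length ≤ 2 * n) :
    queryCode false p.reverse (circuitCode n Gs out) ∈ oracle ↔
      ∃ zs : List (Bool × Bool), zs.length = n ∧ p <+: interleave zs ∧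
        Violates (fun x y => evalList Gs out (x ++ y)) zs := by
  simp only [oracle, Set.mem_ofPred_eq, verify_queryCode, verdict_false, List.reverse_reverse]
  constructor
  · rintro ⟨w, -, h⟩
    exact ⟨_, by simp, prefix_readBits n p w.reverse hp, h⟩
  · rintro ⟨zs, rfl, h, h'⟩
    refine ⟨(interleave zs).reverse, ?_, ?_⟩
    · simpa using le_length_queryCode _ _ _ _ _
    · rwa [List.reverse_reverse, readBits_of_prefix p zs h]

/-- There is a path of length at most two. -/
def Near (n : ℕ) (E : List Bool → List Bool → Bool) (x y : List Bool) : Prop :=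
  ∃ b : List Bool, b.length = n ∧ (x = b ∨ E x b = true) ∧ (b = y ∨ E b y = true)

theorem mem_oracle_true (Gs : List BoolGate) (out : ℕ) (zs : List (Bool × Bool)) :
    queryCode true (interleave zs).reverse (circuitCode zs.length Gs out) ∈ oracle ↔
      Near zs.length (fun x y => evalList Gs out (x ++ y)) (zs.map Prod.fst)
        (zs.map Prod.snd) := by
  -- The query fixes all bits of both endpoints, so the certificate influences only the middle
  -- vertex.
  have key : ∀ W, ((readBits zs.length (interleave zs) W).map (fun s => s.1) = zs.map Prod.fst) ∧
      (readBits zs.length (interleave zs) W).map (fun s => s.2.1) = zs.map Prod.snd := fun W => by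
    constructor <;>
    · conv_rhs => rw [← readBits_interleave zs W]
      simp
  simp only [oracle, Set.mem_ofPred_eq, verify_queryCode, verdict_true, List.reverse_reverse, key]
  constructor
  · rintro ⟨w, -, h⟩
    exact ⟨_, by simp, h⟩
  · rintro ⟨bs, hbs, h⟩
    refine ⟨(interleave (bs.map fun b => (b, b))).reverse, ?_, ?_⟩
    · simpa [hbs] using le_length_queryCode _ _ _ _ _
    · rw [List.reverse_reverse, ← hbs, readBits_cert]
      exact h

end Verifier

/-! ### The oracle machine -/

theorem OracleTM.Run.trans {M : OracleTM} {O : Set (List Bool)} {c c' c'' : M.tm.Cfg} {t t' : ℕ}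
    {qs qs' : List (List Bool)} (h : M.Run O c t qs c') (h' : M.Run O c' t' qs' c'') :
    M.Run O c (t + t') (qs ++ qs') c'' := by
  induction h with
  | refl c => simpa using h'
  | step hl hs _ ih => rw [Nat.add_right_comm]; exact .step hl hs (ih h')
  | query hl _ ih => rw [Nat.add_right_comm]; exact .query hl (ih h')

namespace Searcher

open Verifier (queryCode circuitCode interleave oracle Violates Near evalList)

/-- The stacks of the oracle machine: the input, an auxiliary stack, a counter for the bits of a
violation still to be found, the current bits, the output (also used as an auxiliary stack), and
the oracle stack. -/
inductive Stack
  | inp | rev | left | bits | out | qry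
  deriving DecidableEq

instance : Fintype Stack :=
  ⟨{.inp, .rev, .left, .bits, .out, .qry}, fun k => by cases k <;> decide⟩

/-- The control labels of the oracle machine. -/
inductive Label
  | init | restore | head | copy | copyBack | bits | bitsBack | ask | yes | no | incr | incrBack
  | putKing | putPair | turn | putFirst
  deriving DecidableEq

instance : Fintype Label :=
  ⟨{.init, .restore, .head, .copy, .copyBack, .bits, .bitsBack, .ask, .yes, .no, .incr, .incrBack,
    .putKing, .putPair, .turn, .putFirst}, fun l => by cases l <;> decide⟩

/-- The registers of the oracle machine: whether it looks for a king or for a violation, whether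
a violation exists, the last answer, the carry of the binary counter, and two cells. -/
structure Reg where
  king : Bool
  found : Bool
  ans : Bool
  carry : Bool
  a : Option Bool
  b : Option Bool

noncomputable instance : Fintype Reg :=
  Fintype.ofInjective (fun r => (r.king, r.found, r.ans, r.carry, r.a, r.b)) fun r r' h => by
    cases r; cases r'; simpa using h

/-- The registers with both cells empty. -/
abbrev reg (king found ans carry : Bool) : Reg := ⟨king, found, ans, carry, none, none⟩

/-- Empty the cells. -/
def Reg.clear (r : Reg) : Reg := reg r.king r.found r.ans r.carry

abbrev Stm := Turing.TM2.Stmt (fun _ : Stack => Bool) Label Reg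

open Turing.TM2.Stmt

/-- Empty the cells and go on at a label. -/
def jump (l : Label) : Stm := load Reg.clear (goto fun _ => l)

/-- Read a letter of a stack. -/
def read (k : Stack) (q q' : Stm) : Stm :=
  pop k (fun r a => { r with a := a }) <| branch (fun r => r.a.isSome) q q'

/-- Read two letters of a stack. -/
def readTwo (k : Stack) (q q' : Stm) : Stm :=
  read k (pop k (fun r b => { r with b := b }) q) q'

/-- Write the last letter read. -/
def write (k : Stack) (q : Stm) : Stm := push k (fun r => r.a.getD false) q

/-- The program of the oracle machine. -/
def program : Label → Stm
  | .init =>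
    pop .inp (fun r a => { r with a := a }) <|
      branch (fun r => r.a.getD false)
        (push .rev (fun _ => true) <| push .left (fun _ => true) <| jump .init)
        (push .rev (fun _ => false) <| jump .restore)
  | .restore => read .rev (write .inp <| jump .restore) (jump .head)
  | .head =>
    branch Reg.king (jump .copy) <|
      read .left (push .bits (fun _ => true) <| jump .copy) <|
        branch Reg.found (jump .putPair) (load (fun r => { r with king := true }) <| jump .copy)
  | .copy => read .inp (write .rev <| write .qry <| jump .copy) (jump .copyBack)
  | .copyBack =>
    read .rev (write .inp <| jump .copyBack) (push .qry (fun _ => false) <| jump .bits)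
  | .bits => read .bits (write .out <| jump .bits) (jump .bitsBack)
  | .bitsBack =>
    read .out (write .bits <| write .qry <| push .qry (fun _ => true) <| jump .bitsBack)
      (push .qry Reg.king <| jump .ask)
  -- Never executed: at this label `OracleTM.Run` only admits an oracle query.
  | .ask => halt
  | .yes =>
    branch Reg.king (load (fun r => { r with ans := true, carry := true }) <| jump .incr)
      (load (fun r => { r with found := true }) <| jump .head)
  | .no =>
    branch Reg.king (load (fun r => { r with ans := false, carry := true }) <| jump .incr)
      -- The guessed bit `true` is on top; a negative answer turns it into `false`.
      (pop .bits (fun r _ => r) <| push .bits (fun _ => false) <| jump .head)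
  | .incr =>
    readTwo .bits
      (push .out (fun r => (r.a.getD false) ^^ r.carry) <|
        push .out (fun r => if r.ans then r.b.getD false else r.a.getD false) <|
        load (fun r => { r with carry := r.a.getD false && r.carry }) <| jump .incr)
      (jump .incrBack)
  | .incrBack =>
    read .out (write .bits <| jump .incrBack)
      (branch Reg.carry (jump .putKing) (jump .head))
  | .putKing =>
    readTwo .bits (push .out (fun r => r.b.getD false) <| jump .putKing)
      (push .out (fun _ => true) halt)
  | .putPair =>
    readTwo .bits (write .out <| push .rev (fun r => r.b.getD false) <| jump .putPair) (jump .turn)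
  | .turn => read .rev (write .qry <| jump .turn) (jump .putFirst)
  | .putFirst => read .qry (write .out <| jump .putFirst) (push .out (fun _ => false) halt)

/-- The machine as an oracle machine. -/
noncomputable def machine : OracleTM where
  tm :=
    { K := Stack
      k₀ := .inp
      k₁ := .out
      Γ := fun _ => Bool
      Λ := Label
      main := .init
      σ := Reg
      initialState := reg false false false false
      m := program }
  inputAlphabet := Equiv.refl Bool
  outputAlphabet := Equiv.refl Bool
  kq := Stack.qry
  queryAlphabet := Equiv.refl Bool
  query := Label.ask
  yes := Label.yes
  no := Label.no

/-- The contents of the stacks. -/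
def stk (I R N D T Q : List Bool) : Stack → List Bool
  | .inp => I
  | .rev => R
  | .left => N
  | .bits => D
  | .out => T
  | .qry => Q

section stk

variable (I R N D T Q L : List Bool)

@[simp] theorem stk_inp : stk I R N D T Q .inp = I := rfl
@[simp] theorem stk_rev : stk I R N D T Q .rev = R := rfl
@[simp] theorem stk_left : stk I R N D T Q .left = N := rfl
@[simp] theorem stk_bits : stk I R N D T Q .bits = D := rfl
@[simp] theorem stk_out : stk I R N D T Q .out = T := rfl
@[simp] theorem stk_qry : stk I R N D T Q .qry = Q := rfl

@[simp] theorem update_inp : Function.update (stk I R N D T Q) .inp L = stk L R N D T Q := by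
  funext k; cases k <;> rfl
@[simp] theorem update_rev : Function.update (stk I R N D T Q) .rev L = stk I L N D T Q := by
  funext k; cases k <;> rfl
@[simp] theorem update_left : Function.update (stk I R N D T Q) .left L = stk I R L D T Q := by
  funext k; cases k <;> rfl
@[simp] theorem update_bits : Function.update (stk I R N D T Q) .bits L = stk I R N L T Q := by
  funext k; cases k <;> rfl
@[simp] theorem update_out : Function.update (stk I R N D T Q) .out L = stk I R N D L Q := by
  funext k; cases k <;> rfl
@[simp] theorem update_qry : Function.update (stk I R N D T Q) .qry L = stk I R N D T L := by
  funext k; cases k <;> rfl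

end stk

abbrev Conf := Turing.TM2.Cfg (fun _ : Stack => Bool) Label Reg

/-- The oracle machine goes from `c` to `c'` in at most `T` steps with the queries `qs`. -/
def Runs (T : ℕ) (qs : List (List Bool)) (c c' : Conf) : Prop :=
  ∃ t ≤ T, machine.Run oracle c t qs c'

namespace Runs

variable {T T' : ℕ} {qs qs' : List (List Bool)} {c c' c'' : Conf}

theorem mono (h : Runs T qs c c') (hT : T ≤ T') : Runs T' qs c c' := by
  obtain ⟨t, ht, h⟩ := h
  exact ⟨t, ht.trans hT, h⟩

theorem refl (c : Conf) : Runs 0 [] c c := ⟨0, le_rfl, .refl _⟩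

theorem head {l : Label} {r : Reg} {S : Stack → List Bool} (hl : l ≠ .ask)
    (hs : Turing.TM2.step program ⟨some l, r, S⟩ = some c) (h : Runs T qs c c') :
    Runs (T + 1) qs ⟨some l, r, S⟩ c' := by
  obtain ⟨t, ht, h⟩ := h
  exact ⟨t + 1, by omega, .step (fun e => hl (Option.some.inj e)) hs h⟩

theorem single {l : Label} {r : Reg} {S : Stack → List Bool} (hl : l ≠ .ask)
    (hs : Turing.TM2.step program ⟨some l, r, S⟩ = some c) : Runs 1 [] ⟨some l, r, S⟩ c :=
  head hl hs (refl c)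

theorem trans (h : Runs T qs c c') (h' : Runs T' qs' c' c'') :
    Runs (T + T') (qs ++ qs') c c'' := by
  obtain ⟨t, ht, h⟩ := h
  obtain ⟨t', ht', h'⟩ := h'
  exact ⟨t + t', by omega, h.trans h'⟩

theorem trans_nil (h : Runs T [] c c') (h' : Runs T' qs' c' c'') : Runs (T + T') qs' c c'' :=
  h.trans h'

open Classical in
theorem query (r : Reg) (I R N D T Q : List Bool) :
    Runs 1 [Q] ⟨some .ask, r, stk I R N D T Q⟩
      ⟨some (if Q ∈ oracle then .yes else .no), r, stk I R N D T []⟩ := by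
  have e : machine.queryWord ⟨some .ask, r, stk I R N D T Q⟩ = Q := List.map_id _
  have e' : machine.answer oracle ⟨some .ask, r, stk I R N D T Q⟩ =
      (⟨some (if Q ∈ oracle then .yes else .no), r, stk I R N D T []⟩ : Conf) := by
    change (⟨some (if machine.queryWord ⟨some .ask, r, stk I R N D T Q⟩ ∈ oracle then .yes
      else .no), r, Function.update (stk I R N D T Q) .qry []⟩ : Conf) = _
    rw [e]
    refine congrArg (Turing.TM2.Cfg.mk _ _) ?_
    exact update_qry I R N D T Q []
  refine ⟨1, le_rfl, ?_⟩
  have h := OracleTM.Run.query (M := machine) (O := oracle)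
    (c := ⟨some .ask, r, stk I R N D T Q⟩) rfl (.refl _)
  rw [e, e'] at h
  exact h

end Runs

/-! ### Loops of the oracle machine -/

variable {I R N D T Q : List Bool} {g f s y : Bool}

theorem replicate_append_cons (j : ℕ) (a : Bool) (l : List Bool) :
    List.replicate j a ++ a :: l = a :: (List.replicate j a ++ l) := by
  induction j with
  | zero => rfl
  | succ j ih => simp [List.replicate_succ, ih]

theorem runs_init (j : ℕ) (I R N) :
    Runs (j + 1) [] ⟨some .init, reg g f s y, stk (unaryCode j ++ I) R N D T Q⟩
      ⟨some .restore, reg g f s y,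
        stk I ((unaryCode j).reverse ++ R) (List.replicate j true ++ N) D T Q⟩ := by
  induction j generalizing R N with
  | zero => exact .single nofun (by simp [program, jump, Reg.clear, unaryCode])
  | succ j ih =>
    refine .head (c := ⟨some .init, reg g f s y,
      stk (unaryCode j ++ I) (true :: R) (true :: N) D T Q⟩) nofun ?_ ?_
    · simp [program, jump, Reg.clear, unaryCode, List.replicate_succ]
    · simpa [unaryCode, List.replicate_succ, replicate_append_cons] using
        ih (true :: R) (true :: N)

theorem runs_restore (R I) :
    Runs (R.length + 1) [] ⟨some .restore, reg g f s y, stk I R N D T Q⟩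
      ⟨some .head, reg g f s y, stk (R.reverse ++ I) [] N D T Q⟩ := by
  induction R generalizing I with
  | nil => exact .single nofun (by simp [program, jump, read, Reg.clear])
  | cons a R ih =>
    refine .head (c := ⟨some .restore, reg g f s y, stk (a :: I) R N D T Q⟩) nofun ?_ ?_
    · simp [program, jump, read, write, Reg.clear]
    · simpa using ih (a :: I)

theorem runs_copy (I R Q) :
    Runs (I.length + 1) [] ⟨some .copy, reg g f s y, stk I R N D T Q⟩
      ⟨some .copyBack, reg g f s y, stk [] (I.reverse ++ R) N D T (I.reverse ++ Q)⟩ := by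
  induction I generalizing R Q with
  | nil => exact .single nofun (by simp [program, jump, read, Reg.clear])
  | cons a I ih =>
    refine .head (c := ⟨some .copy, reg g f s y, stk I (a :: R) N D T (a :: Q)⟩) nofun ?_ ?_
    · simp [program, jump, read, write, Reg.clear]
    · simpa using ih (a :: R) (a :: Q)

theorem runs_copyBack (R I) :
    Runs (R.length + 1) [] ⟨some .copyBack, reg g f s y, stk I R N D T Q⟩
      ⟨some .bits, reg g f s y, stk (R.reverse ++ I) [] N D T (false :: Q)⟩ := by
  induction R generalizing I with
  | nil => exact .single nofun (by simp [program, jump, read, Reg.clear])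
  | cons a R ih =>
    refine .head (c := ⟨some .copyBack, reg g f s y, stk (a :: I) R N D T Q⟩) nofun ?_ ?_
    · simp [program, jump, read, write, Reg.clear]
    · simpa using ih (a :: I)

theorem runs_bits (D T) :
    Runs (D.length + 1) [] ⟨some .bits, reg g f s y, stk I R N D T Q⟩
      ⟨some .bitsBack, reg g f s y, stk I R N [] (D.reverse ++ T) Q⟩ := by
  induction D generalizing T with
  | nil => exact .single nofun (by simp [program, jump, read, Reg.clear])
  | cons a D ih =>
    refine .head (c := ⟨some .bits, reg g f s y, stk I R N D (a :: T) Q⟩) nofun ?_ ?_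
    · simp [program, jump, read, write, Reg.clear]
    · simpa using ih (a :: T)

theorem runs_bitsBack (T D Q) :
    Runs (T.length + 1) [] ⟨some .bitsBack, reg g f s y, stk I R N D T Q⟩
      ⟨some .ask, reg g f s y,
        stk I R N (T.reverse ++ D) [] (g :: (T.reverse.flatMap (fun b => [true, b]) ++ Q))⟩ := by
  induction T generalizing D Q with
  | nil => exact .single nofun (by simp [program, jump, read, Reg.clear])
  | cons a T ih =>
    refine .head (c := ⟨some .bitsBack, reg g f s y,
      stk I R N (a :: D) T (true :: a :: Q)⟩) nofun ?_ ?_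
    · simp [program, jump, read, write, Reg.clear]
    · simpa using ih (a :: D) (true :: a :: Q)

-- The code and the bits are each moved away and back, with one closing step per loop, and the query
-- is one more step. The code lands on the oracle stack in reverse order, whence the form of
-- `queryCode`.
open Classical in
theorem runs_query (c N d : List Bool) :
    Runs (2 * c.length + 2 * d.length + 5) [queryCode g d c]
      ⟨some .copy, reg g f s y, stk c [] N d [] []⟩
      ⟨some (if queryCode g d c ∈ oracle then .yes else .no), reg g f s y,
        stk c [] N d [] []⟩ := by
  have h := (runs_copy (N := N) (D := d) (T := []) (g := g) (f := f) (s := s) (y := y) c [] []).trans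
    ((runs_copyBack _ _).trans ((runs_bits _ _).trans ((runs_bitsBack _ _ _).trans
      (Runs.query _ _ _ _ _ _ _))))
  simp only [List.append_nil, List.reverse_reverse, List.nil_append, List.length_reverse] at h
  exact h.mono (by omega)

theorem runs_incrBack (T D) :
    Runs (T.length + 1) [] ⟨some .incrBack, reg g f s y, stk I R N D T Q⟩
      ⟨some (if y then .putKing else .head), reg g f s y, stk I R N (T.reverse ++ D) [] Q⟩ := by
  induction T generalizing D with
  | nil =>
    refine .single nofun ?_
    cases y <;> simp [program, jump, read, Reg.clear]
  | cons a T ih =>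
    refine .head (c := ⟨some .incrBack, reg g f s y, stk I R N (a :: D) T Q⟩) nofun ?_ ?_
    · simp [program, jump, read, write, Reg.clear]
    · simpa using ih (a :: D)

/-- The bits of a list of pairs, with the second components first. -/
def swapped (rs : List (Bool × Bool)) : List Bool := rs.flatMap fun z => [z.2, z.1]

@[simp] theorem swapped_nil : swapped [] = [] := rfl

@[simp] theorem swapped_cons (z : Bool × Bool) (rs : List (Bool × Bool)) :
    swapped (z :: rs) = z.2 :: z.1 :: swapped rs := rfl

@[simp] theorem length_swapped (rs : List (Bool × Bool)) :
    (swapped rs).length = 2 * rs.length := by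
  induction rs with
  | nil => rfl
  | cons z rs ih => simp [ih]; omega

theorem reverse_interleave (zs : List (Bool × Bool)) :
    (interleave zs).reverse = swapped zs.reverse := by
  induction zs with
  | nil => rfl
  | cons z zs ih => simp [ih]; simp [swapped]

/-- The number with the given binary digits, the least significant one being the first. -/
def value : List Bool → ℕ
  | [] => 0
  | b :: l => b.toNat + 2 * value l

theorem value_lt (l : List Bool) : value l < 2 ^ l.length := by
  induction l with
  | nil => simp [value]
  | cons b l ih =>
    have := b.toNat_le
    simp only [value, List.length_cons, pow_succ]
    omega

theorem value_injective {l l' : List Bool} (h : l.length = l'.length) (hv : value l = value l') :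
    l = l' := by
  induction l generalizing l' with
  | nil => exact (List.eq_nil_of_length_eq_zero h.symm).symm
  | cons b l ih =>
    obtain _ | ⟨b', l'⟩ := l'
    · simp at h
    · simp only [value] at hv
      have hb := b.toNat_le
      have hb' := b'.toNat_le
      have h₁ : b.toNat = b'.toNat := by omega
      obtain rfl : b = b' := by cases b <;> cases b' <;> simp_all
      rw [ih (by simpa using h) (by omega)]

/-- A single pass adds the carry to the scanned vertex (second components, least significant bit
first) and, after a negative answer, overwrites the candidate by the old value of that vertex. The
final carry `y'` signals overflow, that is, the end of the scan. -/
theorem runs_incr (rs : List (Bool × Bool)) (y : Bool) (T) :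
    ∃ (rs' : List (Bool × Bool)) (y' : Bool), rs'.length = rs.length ∧
      rs'.map Prod.fst = (if s then rs.map Prod.fst else rs.map Prod.snd) ∧
      value (rs'.map Prod.snd) + 2 ^ rs.length * y'.toNat = value (rs.map Prod.snd) + y.toNat ∧
      Runs (rs.length + 1) [] ⟨some .incr, reg g f s y, stk I R N (swapped rs) T Q⟩
        ⟨some .incrBack, reg g f s y', stk I R N [] ((swapped rs').reverse ++ T) Q⟩ := by
  induction rs generalizing y T with
  | nil =>
    refine ⟨[], y, rfl, by simp, by simp [value], .single nofun ?_⟩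
    simp [program, jump, read, readTwo, Reg.clear]
  | cons z rs ih =>
    obtain ⟨rs', y', h₁, h₂, h₃, h₄⟩ := ih (z.2 && y)
      ((if s then z.1 else z.2) :: (z.2 ^^ y) :: T)
    refine ⟨(if s then z.1 else z.2, z.2 ^^ y) :: rs', y', by simp [h₁], ?_, ?_, ?_⟩
    · cases s <;> simpa using h₂
    · simp only [List.map_cons, value, List.length_cons, pow_succ]
      have : (z.2 ^^ y).toNat + 2 * (z.2 && y).toNat = z.2.toNat + y.toNat := by
        cases z.2 <;> cases y <;> rfl
      linarith
    · refine .head nofun ?_ (by simpa using h₄)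
      simp [program, jump, read, readTwo, Reg.clear]

theorem runs_putKing (rs : List (Bool × Bool)) (T) :
    Runs (rs.length + 1) [] ⟨some .putKing, reg g f s y, stk I R N (swapped rs) T Q⟩
      ⟨none, reg g f s y, stk I R N [] (true :: ((rs.map Prod.fst).reverse ++ T)) Q⟩ := by
  induction rs generalizing T with
  | nil => exact .single nofun (by simp [program, read, readTwo])
  | cons z rs ih =>
    refine .head (c := ⟨some .putKing, reg g f s y, stk I R N (swapped rs) (z.1 :: T) Q⟩)
      nofun ?_ ?_
    · simp [program, jump, read, readTwo, Reg.clear]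
    · simpa using ih (z.1 :: T)

theorem runs_putPair (rs : List (Bool × Bool)) (R T) :
    Runs (rs.length + 1) [] ⟨some .putPair, reg g f s y, stk I R N (swapped rs) T Q⟩
      ⟨some .turn, reg g f s y,
        stk I ((rs.map Prod.fst).reverse ++ R) N [] ((rs.map Prod.snd).reverse ++ T) Q⟩ := by
  induction rs generalizing R T with
  | nil => exact .single nofun (by simp [program, jump, read, readTwo, Reg.clear])
  | cons z rs ih =>
    refine .head (c := ⟨some .putPair, reg g f s y,
      stk I (z.1 :: R) N (swapped rs) (z.2 :: T) Q⟩) nofun ?_ ?_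
    · simp [program, jump, read, readTwo, write, Reg.clear]
    · simpa using ih (z.1 :: R) (z.2 :: T)

theorem runs_turn (R Q) :
    Runs (R.length + 1) [] ⟨some .turn, reg g f s y, stk I R N D T Q⟩
      ⟨some .putFirst, reg g f s y, stk I [] N D T (R.reverse ++ Q)⟩ := by
  induction R generalizing Q with
  | nil => exact .single nofun (by simp [program, jump, read, Reg.clear])
  | cons a R ih =>
    refine .head (c := ⟨some .turn, reg g f s y, stk I R N D T (a :: Q)⟩) nofun ?_ ?_
    · simp [program, jump, read, write, Reg.clear]
    · simpa using ih (a :: Q)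

theorem runs_putFirst (Q T) :
    Runs (Q.length + 1) [] ⟨some .putFirst, reg g f s y, stk I R N D T Q⟩
      ⟨none, reg g f s y, stk I R N D (false :: (Q.reverse ++ T)) []⟩ := by
  induction Q generalizing T with
  | nil => exact .single nofun (by simp [program, read])
  | cons a Q ih =>
    refine .head (c := ⟨some .putFirst, reg g f s y, stk I R N D (a :: T) Q⟩) nofun ?_ ?_
    · simp [program, jump, read, write, Reg.clear]
    · simpa using ih (a :: T)

/-! ### Prefix search for a violation -/

/-- The edge relation of a circuit, on lists of bits. -/
def edge (Gs : List BoolGate) (out : ℕ) (x y : List Bool) : Bool := evalList Gs out (x ++ y)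

theorem interleave_injective {zs zs' : List (Bool × Bool)} (h : interleave zs = interleave zs') :
    zs = zs' := by
  induction zs generalizing zs' with
  | nil => cases zs' with
    | nil => rfl
    | cons z zs' => simp at h
  | cons z zs ih => cases zs' with
    | nil => simp at h
    | cons z' zs' =>
      simp only [Verifier.interleave_cons, List.cons.injEq] at h
      rw [ih h.2.2, Prod.ext h.1 h.2.1]

/-- What is known when the bits `p` of a violation have been searched for: if `f` is true, some
violation starts with `p`, and otherwise the bits are zero and all violations start with them. -/
def Progress (n : ℕ) (E : List Bool → List Bool → Bool) (p : List Bool) (f : Bool) : Prop :=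
  (f = true → ∃ zs : List (Bool × Bool), zs.length = n ∧ p <+: interleave zs ∧ Violates E zs) ∧
    (f = false → (∀ b ∈ p, b = false) ∧
      ∀ zs : List (Bool × Bool), zs.length = n → Violates E zs → p <+: interleave zs)

theorem exists_prefix_append {p l : List Bool} (h : p <+: l) (hl : p.length < l.length) :
    ∃ b, p ++ [b] <+: l := by
  obtain ⟨r, rfl⟩ := h
  obtain _ | ⟨b, r⟩ := r
  · simp at hl
  · exact ⟨b, by simp⟩

theorem Progress.yes {n : ℕ} {E : List Bool → List Bool → Bool} {p : List Bool}
    (h : ∃ zs : List (Bool × Bool), zs.length = n ∧ p <+: interleave zs ∧ Violates E zs) :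
    Progress n E p true :=
  ⟨fun _ => h, nofun⟩

/-- A violation extending `p` has a next bit, as `p` is too short to be complete, and that bit is
not `true`. So the violations extending `p` are those extending `p ++ [false]`. -/
theorem Progress.no {n : ℕ} {E : List Bool → List Bool → Bool} {p : List Bool} {f : Bool}
    (h : Progress n E p f) (hp : p.length < 2 * n)
    (hn : ¬∃ zs : List (Bool × Bool), zs.length = n ∧ p ++ [true] <+: interleave zs ∧
      Violates E zs) : Progress n E (p ++ [false]) f := by
  have key : ∀ zs : List (Bool × Bool), zs.length = n → Violates E zs → p <+: interleave zs →
      p ++ [false] <+: interleave zs := fun zs hz hv hpz => by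
    obtain ⟨b, hb⟩ := exists_prefix_append hpz (by simpa [hz] using hp)
    cases b with
    | false => exact hb
    | true => exact (hn ⟨zs, hz, hb, hv⟩).elim
  refine ⟨fun hf => ?_, fun hf => ⟨?_, fun zs hz hv => key zs hz hv ((h.2 hf).2 zs hz hv)⟩⟩
  · obtain ⟨zs, hz, hpz, hv⟩ := h.1 hf
    exact ⟨zs, hz, key zs hz hv hpz, hv⟩
  · simpa using (h.2 hf).1

theorem length_queryCode (g : Bool) (d c : List Bool) :
    (queryCode g d c).length = c.length + 2 * d.length + 2 := by
  have : ∀ l : List Bool, (l.flatMap (fun b => [true, b])).length = 2 * l.length := fun l => by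
    induction l with
    | nil => rfl
    | cons b l ih =>
      rw [List.flatMap_cons, List.length_append, ih, List.length_cons, List.length_cons,
        List.length_cons, List.length_nil]
      omega
  simp only [queryCode, List.length_cons, List.length_append, this, List.length_reverse]
  omega

/-- A bound for the number of steps between two queries. -/
def roundTime (n : ℕ) (c : List Bool) : ℕ := 2 * c.length + 7 * n + 12

theorem runs_search (n : ℕ) (Gs : List BoolGate) (out j : ℕ) (p : List Bool) (f : Bool)
    (hp : p.length + j = 2 * n) (h : Progress n (edge Gs out) p f) :
    ∃ p' f' qs, p'.length = 2 * n ∧ Progress n (edge Gs out) p' f' ∧ qs.length = j ∧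
      (∀ q ∈ qs, q.length ≤ (circuitCode n Gs out).length + 4 * n + 2) ∧
      Runs (j * roundTime n (circuitCode n Gs out)) qs
        ⟨some .head, reg false f s y,
          stk (circuitCode n Gs out) [] (List.replicate j true) p.reverse [] []⟩
        ⟨some .head, reg false f' s y, stk (circuitCode n Gs out) [] [] p'.reverse [] []⟩ := by
  classical
  set c := circuitCode n Gs out with hc
  induction j generalizing p f with
  | zero => exact ⟨p, f, [], hp, h, rfl, by simp, (Runs.refl _).mono (by simp)⟩
  | succ j ih =>
    have h₁ : Runs 1 []
        ⟨some .head, reg false f s y, stk c [] (List.replicate (j + 1) true) p.reverse [] []⟩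
        ⟨some .copy, reg false f s y,
          stk c [] (List.replicate j true) (p ++ [true]).reverse [] []⟩ :=
      .single nofun (by simp [program, jump, read, Reg.clear, List.replicate_succ])
    have h₂ := h₁.trans_nil (runs_query (g := false) (f := f) (s := s) (y := y) c
      (List.replicate j true) (p ++ [true]).reverse)
    have hm := Verifier.mem_oracle_false n Gs out (p ++ [true]) (by simp; omega)
    have hq : (queryCode false (p ++ [true]).reverse c).length ≤ c.length + 4 * n + 2 := by
      rw [length_queryCode]
      simp
      omega
    have hT : ∀ t, t = 1 + (2 * c.length + 2 * (p ++ [true]).reverse.length + 5) + 1 →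
        t ≤ roundTime n c := by
      rintro t rfl
      simp [roundTime]
      omega
    by_cases ha : queryCode false (p ++ [true]).reverse c ∈ oracle
    · rw [if_pos ha] at h₂
      obtain ⟨p', f', qs, h₃, h₄, h₅, h₆, h₇⟩ := ih (p ++ [true]) true (by simp; omega)
        (.yes (hm.1 ha))
      refine ⟨p', f', _ :: qs, h₃, h₄, by simp [h₅], List.forall_mem_cons.2 ⟨hq, h₆⟩,
        (((h₂.trans (.single nofun ?_)).mono (hT _ rfl)).trans h₇).mono ?_⟩
      · simp [program, jump, Reg.clear]
      · rw [Nat.add_mul, Nat.one_mul, Nat.add_comm]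
    · rw [if_neg ha] at h₂
      obtain ⟨p', f', qs, h₃, h₄, h₅, h₆, h₇⟩ := ih (p ++ [false]) f (by simp; omega)
        (h.no (by omega) fun hn => ha (hm.2 hn))
      refine ⟨p', f', _ :: qs, h₃, h₄, by simp [h₅], List.forall_mem_cons.2 ⟨hq, h₆⟩,
        (((h₂.trans (.single nofun ?_)).mono (hT _ rfl)).trans h₇).mono ?_⟩
      · simp [program, jump, Reg.clear]
      · rw [Nat.add_mul, Nat.one_mul, Nat.add_comm]

/-! ### The scan for a king -/

/-- If `a` is not within distance two of `k` in a tournament, then everything within distance two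
of `k` is within distance two of `a`. -/
theorem Near.of_not_near {n : ℕ} {E : List Bool → List Bool → Bool}
    (hE : ∀ x y : List Bool, x.length = n → y.length = n → x ≠ y → E x y ≠ E y x)
    {k a x : List Bool} (ha : a.length = n) (hka : ¬Near n E k a) (hkx : Near n E k x) :
    Near n E a x := by
  obtain ⟨b, hb, hkb, hbx⟩ := hkx
  refine ⟨b, hb, ?_, hbx⟩
  by_contra! hab
  -- The missing edge from `a` to `b` gives an edge from `b` to `a`, which completes a short path
  -- from `k` to `a`.
  have := hE a b ha hb hab.1
  refine hka ⟨b, hb, hkb, .inr ?_⟩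
  have h₁ := hab.2
  cases h : E b a <;> simp_all

theorem near_self {n : ℕ} {E : List Bool → List Bool → Bool} {a : List Bool} (ha : a.length = n) :
    Near n E a a := ⟨a, ha, .inl rfl, .inl rfl⟩

/-- The first components of `zs` form the candidate, the second ones the vertex being scanned, and
`m` vertices remain. The invariant `hk` says that the candidate is near every vertex already
scanned; it survives a replacement by `Near.of_not_near`. -/
theorem runs_king (n : ℕ) (Gs : List BoolGate) (out m : ℕ) (zs : List (Bool × Bool)) (s y : Bool)
    (hE : ∀ x y : List Bool, x.length = n → y.length = n → x ≠ y →
      edge Gs out x y ≠ edge Gs out y x)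
    (hz : zs.length = n) (hm : value (zs.map Prod.snd).reverse + m = 2 ^ n)
    (hk : ∀ x : List Bool, x.length = n → value x.reverse < value (zs.map Prod.snd).reverse →
      Near n (edge Gs out) (zs.map Prod.fst) x) :
    ∃ k qs r S, k.length = n ∧ (∀ x : List Bool, x.length = n → Near n (edge Gs out) k x) ∧
      qs.length ≤ m ∧ (∀ q ∈ qs, q.length ≤ (circuitCode n Gs out).length + 4 * n + 2) ∧
      Runs (m * roundTime n (circuitCode n Gs out) + n + 1) qs
        ⟨some .copy, reg true f s y,
          stk (circuitCode n Gs out) [] [] (interleave zs).reverse [] []⟩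
        ⟨none, r, S⟩ ∧ S .out = true :: k := by
  classical
  set c := circuitCode n Gs out with hc
  induction m generalizing zs s y with
  | zero =>
    -- Impossible: `n` bits have a value below `2 ^ n`, so at least one vertex remains.
    have := value_lt (zs.map Prod.snd).reverse
    simp [hz] at this
    omega
  | succ m ih =>
    have hq : (queryCode true (interleave zs).reverse c).length ≤ c.length + 4 * n + 2 := by
      rw [length_queryCode, List.length_reverse, Verifier.length_interleave]
      omega
    have hO : queryCode true (interleave zs).reverse c ∈ oracle ↔
        Near n (edge Gs out) (zs.map Prod.fst) (zs.map Prod.snd) := by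
      subst hz
      exact Verifier.mem_oracle_true Gs out zs
    set ans : Bool := decide (queryCode true (interleave zs).reverse c ∈ oracle) with hans
    have h₁ : Runs 1 [] ⟨some (if queryCode true (interleave zs).reverse c ∈ oracle then .yes
          else .no), reg true f s y, stk c [] [] (interleave zs).reverse [] []⟩
        ⟨some .incr, reg true f ans true, stk c [] [] (swapped zs.reverse) [] []⟩ := by
      rw [← reverse_interleave]
      by_cases ha : queryCode true (interleave zs).reverse c ∈ oracle
      · rw [if_pos ha, hans, decide_eq_true ha]
        exact .single nofun (by simp [program, jump, Reg.clear])
      · rw [if_neg ha, hans, decide_eq_false ha]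
        exact .single nofun (by simp [program, jump, Reg.clear])
    obtain ⟨rs, y', h₂, h₃, h₄, h₅⟩ := runs_incr (I := c) (R := []) (N := []) (Q := [])
      (g := true) (f := f) (s := ans) zs.reverse true []
    have h₆ := (runs_query (g := true) (f := f) (s := s) (y := y) c [] (interleave zs).reverse).trans
      (h₁.trans_nil (h₅.trans_nil (runs_incrBack _ _)))
    have e : rs = rs.reverse.reverse := (List.reverse_reverse _).symm
    generalize rs.reverse = zs' at e
    subst e
    simp only [List.length_reverse, List.append_nil, List.reverse_reverse, ← reverse_interleave,
      List.map_reverse, hz, Bool.toNat_true, Verifier.length_interleave] at h₂ h₃ h₄ h₆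
    have hk' : ∀ x : List Bool, x.length = n →
        value x.reverse ≤ value (zs.map Prod.snd).reverse →
        Near n (edge Gs out) (zs'.map Prod.fst) x := by
      intro x hx hv
      have hx' : value x.reverse < value (zs.map Prod.snd).reverse ∨ x = zs.map Prod.snd := by
        obtain hv | hv := hv.lt_or_eq
        · exact .inl hv
        · exact .inr (List.reverse_injective (value_injective (by simp [hx, hz]) hv))
      by_cases ha : queryCode true (interleave zs).reverse c ∈ oracle
      · have e : zs'.map Prod.fst = zs.map Prod.fst := by
          simpa [hans, ha, -List.map_inj_left] using h₃
        rw [e]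
        obtain hx' | rfl := hx'
        · exact hk x hx hx'
        · exact hO.1 ha
      · have e : zs'.map Prod.fst = zs.map Prod.snd := by
          simpa [hans, ha, -List.map_inj_left] using h₃
        rw [e]
        obtain hx' | rfl := hx'
        · exact Near.of_not_near hE (by simp [hz]) (fun h => ha (hO.2 h)) (hk x hx hx')
        · exact near_self hx
    have hT : 2 * c.length + 2 * (2 * n) + 5 + (1 + (n + 1 + (2 * n + 1))) + 1 ≤
        roundTime n c := by
      simp only [roundTime]
      omega
    cases y' with
    | true =>
      have h₇ := runs_putKing (I := c) (R := []) (N := []) (Q := []) (g := true) (f := f)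
        (s := ans) (y := true) zs'.reverse []
      rw [← reverse_interleave] at h₇
      refine ⟨zs'.map Prod.fst, _, _, _, by simp [h₂], fun x hx => hk' x hx ?_, ?_, ?_,
        (h₆.trans h₇).mono ?_, ?_⟩
      -- An overflow means that the vertex just scanned had value `2 ^ n - 1`, so every vertex is
      -- covered.
      · have := value_lt x.reverse
        simp only [List.length_reverse, hx] at this
        simp at h₄
        omega
      · simp
      · simpa using hq
      · rw [Nat.add_mul, Nat.one_mul]
        simp only [List.length_reverse, h₂]
        omega
      · simp
    | false =>
      simp only [Bool.toNat_false, Nat.mul_zero, Nat.add_zero] at h₄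
      obtain ⟨k, qs, r, S, h₇, h₈, h₉, h₁₀, h₁₁, h₁₂⟩ := ih zs' ans false h₂ (by omega)
        fun x hx hv => hk' x hx (by omega)
      have h₁₃ : Runs 1 [] ⟨some .head, reg true f ans false,
          stk c [] [] (interleave zs').reverse [] []⟩
          ⟨some .copy, reg true f ans false, stk c [] [] (interleave zs').reverse [] []⟩ :=
        .single nofun (by simp [program, jump, Reg.clear])
      refine ⟨k, _, r, S, h₇, h₈, ?_, ?_, (h₆.trans (h₁₃.trans_nil h₁₁)).mono ?_, h₁₂⟩
      · simpa using h₉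
      · simpa [hq] using h₁₀
      · rw [Nat.add_mul, Nat.one_mul]
        omega

/-! ### Solutions, lengths of codes and the complete run -/

theorem exists_ofFn_eq {n : ℕ} {l : List Bool} (h : l.length = n) :
    ∃ x : Fin n → Bool, List.ofFn x = l := by
  subst h
  exact ⟨l.get, List.ofFn_get l⟩

theorem kingEdge_eq {n : ℕ} (C : BoolCircuit (n + n)) (x y : Fin n → Bool) :
    kingEdge C x y = edge C.gates C.out (List.ofFn x) (List.ofFn y) := by
  rw [kingEdge, BoolCircuit.eval, BoolCircuit.wires, edge, evalList, List.ofFn_fin_append]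

theorem isSolution_violation {n : ℕ} {C : BoolCircuit (n + n)} {zs : List (Bool × Bool)}
    (h : Violates (edge C.gates C.out) zs) {x y : Fin n → Bool}
    (hx : List.ofFn x = zs.map Prod.fst) (hy : List.ofFn y = zs.map Prod.snd) :
    (KingAnswer.violation x y).IsSolution C := by
  rw [KingAnswer.IsSolution, kingEdge_eq, kingEdge_eq, hx, hy]
  refine ⟨?_, h.2⟩
  rintro rfl
  exact h.1 (hx.symm.trans hy)

/-- `Near` allows the middle vertex to coincide with an endpoint; as `a ≠ k`, the path then
degenerates to the edge from `k` to `a`. -/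
theorem isSolution_king {n : ℕ} {C : BoolCircuit (n + n)} {k : Fin n → Bool}
    (h : ∀ x : List Bool, x.length = n → Near n (edge C.gates C.out) (List.ofFn k) x) :
    (KingAnswer.king k).IsSolution C := by
  intro a ha
  obtain ⟨b, hb, hkb, hba⟩ := h (List.ofFn a) (by simp)
  obtain ⟨b, rfl⟩ := exists_ofFn_eq hb
  simp only [List.ofFn_inj, ← kingEdge_eq] at hkb hba
  by_cases hbk : b = k
  · subst hbk
    exact .inl (hba.resolve_left ha.symm)
  · by_cases hb' : b = a
    · subst hb'
      exact .inl (hkb.resolve_left (Ne.symm hbk))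
    · exact .inr ⟨b, hbk, hb', hkb.resolve_left (Ne.symm hbk), hba.resolve_left hb'⟩

theorem length_encode_gate {m : ℕ} (G : BoolGate) (h : ∀ i ∈ G.args, i < m) :
    G.encode.length ≤ 2 * m + 3 := by
  cases G <;> simp [BoolGate.args, BoolGate.encode, unaryCode] at h ⊢ <;> omega

/-- Wire numbers are below `2 * (n + C.size)`, and each gate writes at most two of them in unary,
with at most three further letters. -/
theorem length_circuitCode {n : ℕ} (C : BoolCircuit (n + n)) :
    (circuitCode n C.gates C.out).length ≤
      4 * (n + C.size) ^ 2 + 7 * (n + C.size) + 1 := by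
  have h : ∀ Gs : List BoolGate, (∀ G ∈ Gs, G.encode.length ≤ 2 * (2 * (n + C.size)) + 3) →
      (Gs.flatMap BoolGate.encode).length ≤ Gs.length * (2 * (2 * (n + C.size)) + 3) := by
    intro Gs hG
    induction Gs with
    | nil => simp
    | cons G Gs ih =>
      have h₁ := hG G (by simp)
      have h₂ := ih fun G' h' => hG G' (by simp [h'])
      rw [List.flatMap_cons, List.length_append, List.length_cons, Nat.add_mul]
      omega
  have hG := h C.gates fun G hG => by
    obtain ⟨t, ht, rfl⟩ := List.getElem_of_mem hG
    refine length_encode_gate _ fun i hi => (C.args_lt t ht i hi).trans_le ?_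
    rw [BoolCircuit.size]
    omega
  have ho := C.out_lt
  have hs : C.gates.length = C.size := rfl
  rw [hs] at ho hG
  simp only [circuitCode, unaryCode, List.length_append, List.length_replicate, List.length_cons,
    List.length_nil]
  nlinarith [Nat.mul_le_mul_right (2 * (2 * (n + C.size)) + 3) (Nat.le_add_left C.size n)]

/-- The input configuration. -/
theorem initList_eq (c : List Bool) :
    (Turing.initList machine.tm (c.map machine.inputAlphabet.symm) : Conf) =
      ⟨some .init, reg false false false false, stk c [] [] [] [] []⟩ := by
  refine congrArg (Turing.TM2.Cfg.mk _ _) (funext fun k => ?_)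
  cases k <;> first | rfl | exact List.map_id _

theorem exists_runs (n : ℕ) (C : BoolCircuit (n + n)) :
    ∃ (a : KingAnswer n) (qs : List (List Bool)) (r : Reg) (S : Stack → List Bool),
      a.IsSolution C ∧ qs.length ≤ 2 ^ n + 2 * n ∧
      (∀ q ∈ qs, q.length ≤ (circuitCode n C.gates C.out).length + 4 * n + 2) ∧
      Runs (((2 * n + 1) * roundTime n (circuitCode n C.gates C.out) + 8 * n + 8) * 2 ^ n) qs
        ⟨some .init, reg false false false false, stk C.encode [] [] [] [] []⟩ ⟨none, r, S⟩ ∧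
      S .out = a.encode := by
  have hC : C.encode = circuitCode n C.gates C.out := rfl
  rw [hC]
  set c := circuitCode n C.gates C.out with hc
  set E := edge C.gates C.out with hE
  set K := roundTime n c with hK
  have hpow : 1 ≤ 2 ^ n := Nat.one_le_two_pow
  have h₁ : Runs (4 * n + 3) [] ⟨some .init, reg false false false false, stk c [] [] [] [] []⟩
      ⟨some .head, reg false false false false,
        stk c [] (List.replicate (2 * n) true) [] [] []⟩ := by
    have h := (runs_init (D := []) (T := []) (Q := []) (g := false) (f := false) (s := false)
      (y := false) (n + n) (unaryCode C.out ++ C.gates.flatMap BoolGate.encode) [] []).trans_nil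
      (runs_restore _ _)
    simp only [List.append_nil, List.reverse_reverse, List.length_reverse, ← two_mul n] at h
    have hl : (unaryCode (2 * n)).length = 2 * n + 1 := by simp [unaryCode]
    have hc' : c = unaryCode (2 * n) ++ (unaryCode C.out ++ C.gates.flatMap BoolGate.encode) := by
      simp [hc, circuitCode, two_mul]
    rw [hl, ← hc'] at h
    exact h.mono (by omega)
  obtain ⟨p, f, qs, hp, hpr, hqs, hq, h₂⟩ := runs_search (s := false) (y := false) n C.gates C.out
    (2 * n) [] false (by simp) ⟨nofun, fun _ => by simp⟩
  have h₃ := h₁.trans_nil h₂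
  cases f with
  | true =>
    obtain ⟨zs, hz, hpz, hv⟩ := hpr.1 rfl
    obtain rfl := hpz.eq_of_length (by simp [hp, hz])
    obtain ⟨x, hx⟩ := exists_ofFn_eq (n := n) (l := zs.map Prod.fst) (by simp [hz])
    obtain ⟨y, hy⟩ := exists_ofFn_eq (n := n) (l := zs.map Prod.snd) (by simp [hz])
    rw [reverse_interleave] at h₃
    have h₄ : Runs 1 [] ⟨some .head, reg false true false false,
        stk c [] [] (swapped zs.reverse) [] []⟩
        ⟨some .putPair, reg false true false false, stk c [] [] (swapped zs.reverse) [] []⟩ :=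
      .single nofun (by simp [program, jump, read, Reg.clear])
    have h₅ := h₃.trans (h₄.trans_nil ((runs_putPair _ _ _).trans_nil
      ((runs_turn _ _).trans_nil (runs_putFirst _ _))))
    refine ⟨.violation x y, _, _, _, isSolution_violation hv hx hy, ?_, ?_, h₅.mono ?_, ?_⟩
    · simp only [List.append_nil, hqs]; omega
    · simpa using hq
    · refine le_trans ?_ (Nat.le_mul_of_pos_right _ hpow)
      simp [hz, Nat.add_mul, ← hc, ← hK]
      omega
    · simp [KingAnswer.encode, hx, hy]
  | false =>
    obtain ⟨hp₀, hpz⟩ := hpr.2 rfl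
    have hp' : p = interleave (List.replicate n (false, false)) := by
      have e : ∀ n, interleave (List.replicate n (false, false)) =
          List.replicate (2 * n) false := fun n => by
        induction n with
        | zero => rfl
        | succ n ih => rw [List.replicate_succ, Verifier.interleave_cons, ih]; rfl
      rw [e, List.eq_replicate_iff]
      exact ⟨hp, hp₀⟩
    -- The complete prefix `p` is zero and starts every violation, so a violation would consist of
    -- two equal vertices.
    have hT : ∀ x y : List Bool, x.length = n → y.length = n → x ≠ y → E x y ≠ E y x := by
      intro x y hx hy hxy he
      have e₁ : (x.zip y).map Prod.fst = x := List.map_fst_zip (by omega)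
      have e₂ : (x.zip y).map Prod.snd = y := List.map_snd_zip (by omega)
      have h := hpz (x.zip y) (by simp [hx, hy]) ⟨by rwa [e₁, e₂], by rwa [e₁, e₂]⟩
      have h' := interleave_injective (hp'.symm.trans (h.eq_of_length (by simp [hp, hx, hy])))
      rw [← h'] at e₁ e₂
      exact hxy (by rw [← e₁, ← e₂]; simp)
    have h₄ : Runs 1 [] ⟨some .head, reg false false false false, stk c [] [] p.reverse [] []⟩
        ⟨some .copy, reg true false false false, stk c [] [] p.reverse [] []⟩ :=
      .single nofun (by simp [program, jump, read, Reg.clear])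
    have hv : ∀ n, value (List.replicate n false) = 0 := fun n => by
      induction n with
      | zero => rfl
      | succ n ih => simp [List.replicate_succ, value, ih]
    -- The zero bits left by the search serve, without a reset, as initial candidate and initial
    -- scanned vertex; the invariant is vacuous at value `0`.
    obtain ⟨k, qs', r, S, hk, hkn, hqs', hq', h₅, hS⟩ := runs_king (f := false) n C.gates C.out
      (2 ^ n) (List.replicate n (false, false)) false false hT (by simp) (by simp [hv])
      (by simp [hv])
    obtain ⟨k, rfl⟩ := exists_ofFn_eq hk
    rw [← hp'] at h₅
    refine ⟨.king k, qs ++ qs', r, S, isSolution_king hkn, ?_, ?_,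
      (h₃.trans (h₄.trans_nil h₅)).mono ?_, hS⟩
    · rw [List.length_append, hqs]; omega
    · intro q h
      obtain h | h := List.mem_append.1 h
      · exact hq q h
      · exact hq' q h
    -- Reading the input, `2 * n` search rounds, the switch to the scan, then `2 ^ n` rounds and the
    -- output. Only the scan is exponential; the rest is absorbed by `1 ≤ 2 ^ n`.
    · change 4 * n + 3 + 2 * n * K + (1 + (2 ^ n * K + n + 1)) ≤ _
      calc 4 * n + 3 + 2 * n * K + (1 + (2 ^ n * K + n + 1))
          ≤ (2 * n * K + 8 * n + 8) + 2 ^ n * K := by omega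
        _ ≤ (2 * n * K + 8 * n + 8) * 2 ^ n + 2 ^ n * K :=
          Nat.add_le_add_right (Nat.le_mul_of_pos_right _ hpow) _
        _ = _ := by ring

end Searcher

theorem mainTheorem12 :
    ∃ L : Set (List Bool), InNP L ∧
      ∃ (M : OracleTM) (p : Polynomial ℕ),
        ∀ (n : ℕ) (C : BoolCircuit (n + n)),
          ∃ (a : KingAnswer n) (t : ℕ) (qs : List (List Bool)),
            a.IsSolution C ∧
            M.Computes L C.encode a.encode t qs ∧
            t ≤ p.eval (n + C.size) * 2 ^ n ∧
            qs.length ≤ 2 ^ n + p.eval (n + C.size) ∧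
            ∀ q ∈ qs, q.length ≤ p.eval (n + C.size) := by
  refine ⟨Verifier.oracle, Verifier.inNP_oracle, Searcher.machine,
    -- The quadratic factor bounds `roundTime`: twice the bound of `length_circuitCode`, plus `7 * n
    -- + 12`. The whole then also bounds the lengths of the queries and the `2 * n` extra queries.
    (2 * Polynomial.X + 1) * (8 * Polynomial.X ^ 2 + 21 * Polynomial.X + 14) + 8 * Polynomial.X + 8,
    fun n C => ?_⟩
  obtain ⟨a, qs, r, S, ha, hqs, hq, ⟨t, ht, h⟩, hS⟩ := Searcher.exists_runs n C
  have hc := Searcher.length_circuitCode C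
  have hp : (2 * (n + C.size) + 1) * (8 * (n + C.size) ^ 2 + 21 * (n + C.size) + 14) +
      8 * (n + C.size) + 8 = ((2 * Polynomial.X + 1) *
        (8 * Polynomial.X ^ 2 + 21 * Polynomial.X + 14) + 8 * Polynomial.X + 8 :
          Polynomial ℕ).eval (n + C.size) := by simp
  rw [← hp]
  have hn : n ≤ n + C.size := Nat.le_add_right _ _
  generalize n + C.size = N at *
  have hN : 8 * N ^ 2 + 21 * N + 14 ≤ (2 * N + 1) * (8 * N ^ 2 + 21 * N + 14) :=
    Nat.le_mul_of_pos_left _ (by omega)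
  refine ⟨a, t, qs, ha, ⟨⟨none, r, S⟩, ?_, rfl, ?_⟩, ht.trans ?_, hqs.trans (by omega),
    fun q h => (hq q h).trans (by omega)⟩
  · exact (congrArg (fun c : Searcher.Conf => Searcher.machine.Run Verifier.oracle c t qs
      ⟨none, r, S⟩) (Searcher.initList_eq C.encode)).mpr h
  · exact (List.map_id _).trans hS
  · refine Nat.mul_le_mul_right _ ?_
    have : (2 * n + 1) * Searcher.roundTime n (Verifier.circuitCode n C.gates C.out) ≤
        (2 * N + 1) * (8 * N ^ 2 + 21 * N + 14) :=
      Nat.mul_le_mul (by omega) (by rw [Searcher.roundTime]; omega)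
    omega
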